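/- Let $q$ be a prime power, let $\mathbb{F}_q$ be the finite field with $q$ elements, and for $n\ge 0$ let $M(\mathbb{F}_q^n)$ be the matroid on the set $\mathbb{F}_q^n$ whose independent sets are the linearly independent subsets; its flats are the linear subspaces of $\mathbb{F}_q^n$. For a finite matroid $M$ with lattice of flats $L$ and minimal flat $\bot$, the Chow ring of $M$ is $$A(M)=\mathbb{Z}[x_F : F\in L\setminus\{\bot\}]/(I_1+I_2),$$ where $I_1$ is generated by the products $x_Fx_G$ with $F,G$ incomparable, and $I_2$ is generated by the sums $\sum_{F\ni i}x_F$, one for each element $i$ of the ground set that is not a loop. It is graded by giving every $x_F$ degree $1$. Let $$h_n(t)=\sum_{d\ge 0}\operatorname{rank}_{\mathbb{Z}}\big(A(M(\mathbb{F}_q^n))_d\big)\,t^d$$ be its Hilbert series (for $n=0$ there are no variables, so $A(M(\mathbb{F}_q^0))=\mathbb{Z}$ and $h_0=1$). Put $[i]_q=1+q+\dots+q^{i-1}$, $[n]_q!=[1]_q[2]_q\cdots[n]_q$ and $e_q(x)=\sum_{n\ge 0}\frac{x^n}{[n]_q!}$. Then $t\,e_q(x)-e_q(tx)$ is invertible in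 $\mathbb{Q}[[t]][[x]]$, and in this ring $$\sum_{n\ge 0}h_n(t)\frac{x^n}{[n]_q!}=\frac{(t-1)\,e_q(x)}{t\,e_q(x)-e_q(tx)}.$$ -/

import Mathlib

/-- The Hilbert series `∑ d, (rank of 𝒜 d over ℤ) t ^ d` of a `ℤ`-algebra with homogeneous
components `𝒜 d`. It is a formal power series in `t`; its coefficients are regarded as rational
numbers. -/
noncomputable def hilbertSeries {R : Type*} [CommRing R] (𝒜 : ℕ → Submodule ℤ R) :
    PowerSeries ℚ :=
  PowerSeries.mk fun d => (Module.finrank ℤ (𝒜 d) : ℚ)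

namespace Matroid

variable {α : Type*}

/-- The flats of `M` other than the minimal flat `⊥` (the closure of the empty set). -/
abbrev NonbotFlat (M : Matroid α) : Type _ :=
  {F : Set α // M.IsFlat F ∧ F ≠ M.closure ∅}

/-- The linear form `∑ x_F`, the sum running over the flats `F ≠ ⊥` containing `i`. -/
noncomputable def flatSum [Finite α] (M : Matroid α) (i : α) : MvPolynomial M.NonbotFlat ℤ :=
  ∑ᶠ (F : M.NonbotFlat) (_ : i ∈ F.1), MvPolynomial.X F

/-- The ideal of relations of the Chow ring: `x_F x_G` for incomparable flats `F`, `G`, and the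
linear forms `∑_{i ∈ F} x_F`, one for each element `i` of the ground set that is not a loop
(that is, one for each atom of the lattice of flats; a loop lies in every flat, including `⊥`,
for which there is no variable). -/
noncomputable def chowIdeal [Finite α] (M : Matroid α) : Ideal (MvPolynomial M.NonbotFlat ℤ) :=
  Ideal.span {p | ∃ F G : M.NonbotFlat, ¬ F.1 ⊆ G.1 ∧ ¬ G.1 ⊆ F.1 ∧
    p = MvPolynomial.X F * MvPolynomial.X G} ⊔
  Ideal.span {p | ∃ i : α, M.IsNonloop i ∧ p = M.flatSum i}

/-- The Chow ring `A(M)` of a finite matroid. -/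
abbrev ChowRing [Finite α] (M : Matroid α) : Type _ :=
  MvPolynomial M.NonbotFlat ℤ ⧸ M.chowIdeal

/-- The degree `d` component of `A(M)`: the classes of the homogeneous polynomials of degree `d`
(all variables having degree one). -/
noncomputable def chowComponent [Finite α] (M : Matroid α) (d : ℕ) : Submodule ℤ M.ChowRing :=
  (MvPolynomial.homogeneousSubmodule M.NonbotFlat ℤ d).map
    (Ideal.Quotient.mkₐ ℤ M.chowIdeal).toLinearMap

/-- The matroid on all vectors of a finite vector space `V` over `K` whose independent sets are the
linearly independent subsets of `V`. -/
noncomputable def ofVectorSpace (K V : Type*) [Field K] [AddCommGroup V] [Module K V] [Finite V] :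
    Matroid V :=
  (IndepMatroid.ofFinite (E := Set.univ) Set.finite_univ
    (fun I => LinearIndepOn K id I)
    (linearIndepOn_empty K id)
    (fun _ _ hJ hIJ => hJ.mono hIJ)
    (by
      intro I J hI hJ hlt
      by_contra! h
      have hJI : J ⊆ Submodule.span K I := by
        intro e he
        by_cases heI : e ∈ I
        · exact Submodule.subset_span heI
        · by_contra hns
          exact h e he heI (hI.id_insert hns)
      have : Fintype I := Fintype.ofFinite I
      have : Fintype J := Fintype.ofFinite J
      have h1 := finrank_span_set_eq_card hI
      have h2 := finrank_span_set_eq_card hJ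
      have h3 := Submodule.finrank_mono (Submodule.span_le.2 hJI)
      rw [h1, h2, ← Set.ncard_eq_toFinset_card', ← Set.ncard_eq_toFinset_card'] at h3
      omega)
    (fun I _ => Set.subset_univ I)).matroid

end Matroid

/-- The `q`-factorial `[n]_q! = [1]_q [2]_q ⋯ [n]_q`, where `[i]_q = 1 + q + ⋯ + q ^ (i - 1)`. -/
def qFactorial (q n : ℕ) : ℕ :=
  ∏ i ∈ Finset.Icc 1 n, ∑ j ∈ Finset.range i, q ^ j

/-- The `q`-exponential generating function `∑ n, a_n(t) x ^ n / [n]_q!` of a sequence of power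
series `a_n(t)`; the inner power series variable is `t`, the outer one is `x`. -/
noncomputable def qEGF (q : ℕ) (a : ℕ → PowerSeries ℚ) : PowerSeries (PowerSeries ℚ) :=
  PowerSeries.mk fun n => ((qFactorial q n : ℚ)⁻¹) • a n

/-- The `q`-exponential function `e_q(x) = ∑ n, x ^ n / [n]_q!`. -/
noncomputable def qExp (q : ℕ) : PowerSeries (PowerSeries ℚ) :=
  qEGF q fun _ => 1

/-! Replace the generators `x_a` by the upper sums `h a = ∑_{b ≥ a} x_b`. The relations of the Chow
ring become `(h a - h (a ⊔ b)) * (h b - h (a ⊔ b)) = 0` together with `h i = 0` for atoms. The point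
is that the nested monomials of degree `d` (products along chains `a₁ < a₂ < ⋯` in which the
multiplicity of `a_j` is less than its rank jump over `a_{j-1}`, with `a₀ = ⊥`) form a `ℤ`-basis of
the degree `d` component.

They span because the relations rewrite any other monomial into monomials of the same degree and
larger total rank (`IsChowFamily.prod_mem_nestedSpan`).

They are independent because each has a functional that kills all relations, takes the value 1 on
it, and is otherwise supported on monomials of smaller total rank (`IsNested.exists_functional`).
These functionals are products of degree functions of intervals `[c, v]`, and each such degree
function is the indicator of a Hall–Rado condition. That the indicator respects the quadrics is an
uncrossing argument from submodularity (`intervalDegree_quadric`).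

The Hilbert series thus counts nested multisets. Removing all copies of the top element gives, for
the series `N_v` of those with supremum `v ≠ ⊥`, the recursion `∑_{w ≤ v} (t - t ^ (r v - r w)) N_w
= 0`, with `N_⊥ = 1`. In the subspace lattice the number of `w` of each rank below `v` is a Gaussian
binomial, so this is the recursion for the coefficients of `(t - 1) / (t e_q(x) - e_q(t x))`.
Summing `N_v` over all `v` multiplies that series by `e_q(x)`. -/

/-- The properties of the rank function of a geometric lattice. -/
structure IsGeometricRank {L : Type*} [Lattice L] [BoundedOrder L] (r : L → ℕ) : Prop where
  bot : r ⊥ = 0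
  strictMono : StrictMono r
  submodular : ∀ a b, r (a ⊔ b) + r (a ⊓ b) ≤ r a + r b
  exists_atom : ∀ a b, a < b → ∃ i, r i = 1 ∧ i ≤ b ∧ ¬ i ≤ a

/-- The relations satisfied by the sums `h a = ∑_{b ≥ a} x_b` in the Chow ring. -/
structure IsChowFamily {L A : Type*} [Lattice L] [CommRing A] (r : L → ℕ) (h : L → A) :
    Prop where
  quadric : ∀ a b, (h a - h (a ⊔ b)) * (h b - h (a ⊔ b)) = 0
  atom : ∀ i, r i = 1 → h i = 0

/-! ### Straightening: nested monomials span. -/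

section Nested

variable {L : Type*} [Lattice L] [BoundedOrder L]

open scoped Classical in
/-- A multiset is nested if it is supported on a chain avoiding `⊥` and every `a` occurs less
often than `r a - r b`, for all smaller elements `b` of the chain and for `b = ⊥`. -/
def IsNested (r : L → ℕ) (s : Multiset L) : Prop :=
  (∀ a ∈ s, a ≠ ⊥) ∧ (∀ a ∈ s, ∀ b ∈ s, a ≤ b ∨ b ≤ a) ∧
    ∀ a ∈ s, ∀ b, b = ⊥ ∨ b ∈ s → b < a → s.count a + r b < r a

variable {r : L → ℕ}

namespace IsGeometricRank

theorem rank_sup_atom (hr : IsGeometricRank r) {a i : L} (hi : r i = 1) (hia : ¬ i ≤ a) :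
    r (a ⊔ i) = r a + 1 := by
  have h1 : a ⊓ i < i := lt_of_le_of_ne inf_le_right fun h => hia (h ▸ inf_le_left)
  have h2 : a < a ⊔ i := lt_of_le_of_ne le_sup_left fun h => hia (h ▸ le_sup_right)
  have := hr.strictMono h1
  have := hr.strictMono h2
  have := hr.submodular a i
  omega

theorem pos_of_ne_bot (hr : IsGeometricRank r) {a : L} (ha : a ≠ ⊥) : 0 < r a := by
  have := hr.strictMono (bot_lt_iff_ne_bot.2 ha)
  omega

end IsGeometricRank

namespace IsChowFamily

variable {A : Type*} [CommRing A] {h : L → A}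

/-- For an atom `i` not below `a`, the quadric reads `h a * h (a ⊔ i) = h (a ⊔ i) ^ 2`, since `h i =
0`. Climbing from `a` to `b` through atoms takes `k` such steps, each paid for by one factor `h b`.
-/
theorem mul_pow (hr : IsGeometricRank r) (hh : IsChowFamily r h) (k : ℕ) (a b : L) (hab : a ≤ b)
    (hk : r b = r a + k) : h a * h b ^ k = h b ^ (k + 1) := by
  induction k generalizing a with
  | zero =>
    obtain rfl | hlt := hab.eq_or_lt
    · simp
    · have := hr.strictMono hlt
      omega
  | succ k ih =>
    have hlt : a < b := lt_of_le_of_ne hab (by rintro rfl; omega)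
    obtain ⟨i, hi, hib, hia⟩ := hr.exists_atom a b hlt
    have h1 := hr.rank_sup_atom hi hia
    have h2 := ih (a ⊔ i) (sup_le hab hib) (by omega)
    have h3 := hh.quadric a i
    rw [hh.atom i hi] at h3
    calc h a * h b ^ (k + 1) = h a * (h (a ⊔ i) * h b ^ k) := by rw [h2]
      _ = h (a ⊔ i) * (h (a ⊔ i) * h b ^ k) := by linear_combination -h b ^ k * h3
      _ = h (a ⊔ i) * h b ^ k * h b := by rw [h2]; linear_combination h b * h2
      _ = h b ^ (k + 1 + 1) := by rw [h2]; ring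

/-- Climb to `a` from an atom below it, where `h` vanishes. -/
theorem pow_rank (hr : IsGeometricRank r) (hh : IsChowFamily r h) (a : L) (ha : a ≠ ⊥) :
    h a ^ r a = 0 := by
  obtain ⟨i, hi, hia, -⟩ := hr.exists_atom ⊥ a (bot_lt_iff_ne_bot.2 ha)
  have h1 := hr.pos_of_ne_bot ha
  have h2 := hh.mul_pow hr (r a - 1) i a hia (by omega)
  rwa [hh.atom i hi, zero_mul, show r a - 1 + 1 = r a by omega, eq_comm] at h2

/-- The span of the nested monomials of degree `d`. -/
def nestedSpan (r : L → ℕ) (h : L → A) (d : ℕ) : Submodule ℤ A :=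
  Submodule.span ℤ {p | ∃ s : Multiset L, IsNested r s ∧ s.card = d ∧ p = (s.map h).prod}

open scoped Classical in
-- Each rewriting step keeps the degree and raises the total rank, which is at most `s.card * r ⊤`.
-- The induction variable `m` bounds the room left.
theorem prod_mem_nestedSpan (hr : IsGeometricRank r) (hh : IsChowFamily r h) (m : ℕ)
    (s : Multiset L) (hs : ∀ a ∈ s, a ≠ ⊥) (hm : s.card * r ⊤ < (s.map r).sum + m) :
    (s.map h).prod ∈ nestedSpan r h s.card := by
  induction m generalizing s with
  | zero =>
    have := Multiset.sum_le_card_nsmul (s.map r) (r ⊤) (by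
      intro x hx
      obtain ⟨a, -, rfl⟩ := Multiset.mem_map.1 hx
      exact hr.strictMono.monotone le_top)
    rw [Multiset.card_map, smul_eq_mul] at this
    omega
  | succ m ih =>
    by_cases hn : IsNested r s
    · exact Submodule.subset_span ⟨s, hn, rfl, rfl⟩
    by_cases hc : ∀ a ∈ s, ∀ b ∈ s, a ≤ b ∨ b ≤ a
    · have : ∃ a ∈ s, ∃ b, (b = ⊥ ∨ b ∈ s) ∧ b < a ∧ r a ≤ s.count a + r b := by
        by_contra! hcon
        exact hn ⟨hs, hc, fun a ha b hb hba => hcon a ha b hb hba⟩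
      obtain ⟨a, ha, b, hb, hba, hle⟩ := this
      have hrk := hr.strictMono hba
      -- If the violated bound is the one against `⊥`, then `h a` occurs at least `r a` times and
      -- the monomial is zero. Otherwise one smaller factor `h b` is absorbed into the power of `h
      -- a`.
      obtain rfl | hb := hb
      · rw [hr.bot, add_zero, Multiset.le_count_iff_replicate_le] at hle
        obtain ⟨u, rfl⟩ := Multiset.le_iff_exists_add.1 hle
        rw [Multiset.map_add, Multiset.prod_add, Multiset.map_replicate, Multiset.prod_replicate,
          hh.pow_rank hr a (hs a ha), zero_mul]
        exact Submodule.zero_mem _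
      · have hle' : Multiset.replicate (r a - r b) a ≤ s.erase b := by
          rw [← Multiset.le_count_iff_replicate_le, Multiset.count_erase_of_ne hba.ne']
          omega
        obtain ⟨u, hu⟩ := Multiset.le_iff_exists_add.1 hle'
        obtain rfl : s = b ::ₘ (Multiset.replicate (r a - r b) a + u) := by
          rw [← hu, Multiset.cons_erase hb]
        have key := hh.mul_pow hr (r a - r b) b a hba.le (by omega)
        have h1 := ih (a ::ₘ (Multiset.replicate (r a - r b) a + u)) (by
          intro c hc'
          rcases Multiset.mem_cons.1 hc' with rfl | hc'
          · exact hs c ha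
          · exact hs c (Multiset.mem_cons_of_mem hc')) (by
          simp only [Multiset.card_cons, Multiset.map_cons, Multiset.sum_cons] at hm ⊢
          omega)
        simp only [Multiset.map_cons, Multiset.map_add, Multiset.map_replicate,
          Multiset.prod_cons, Multiset.prod_add, Multiset.prod_replicate,
          Multiset.card_cons] at h1 ⊢
        rwa [← mul_assoc, key, pow_succ', mul_assoc]
    · push Not at hc
      obtain ⟨a, ha, b, hb, hab, hba⟩ := hc
      have hne : b ≠ a := by rintro rfl; exact hab le_rfl
      obtain ⟨u, rfl⟩ : ∃ u, s = a ::ₘ b ::ₘ u := by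
        obtain ⟨u, rfl⟩ := Multiset.exists_cons_of_mem ha
        rcases Multiset.mem_cons.1 hb with h | h
        · exact absurd h hne
        · obtain ⟨v, rfl⟩ := Multiset.exists_cons_of_mem h
          exact ⟨v, rfl⟩
      have ra : r a < r (a ⊔ b) := hr.strictMono
        (lt_of_le_of_ne le_sup_left fun h => hba (h ▸ le_sup_right))
      have rb : r b < r (a ⊔ b) := hr.strictMono
        (lt_of_le_of_ne le_sup_right fun h => hab (h ▸ le_sup_left))
      have hJ : a ⊔ b ≠ ⊥ := fun h => by rw [h, hr.bot] at ra; omega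
      have main : ∀ c d, c ≠ ⊥ → d ≠ ⊥ → r a + r b < r c + r d →
          h c * (h d * (u.map h).prod) ∈ nestedSpan r h (u.card + 1 + 1) := by
        intro c d hc hd hcd
        have := ih (c ::ₘ d ::ₘ u) (by
          intro x hx
          simp only [Multiset.mem_cons] at hx
          rcases hx with rfl | rfl | hx
          · exact hc
          · exact hd
          · exact hs x (by simp [hx])) (by
          simp only [Multiset.card_cons, Multiset.map_cons, Multiset.sum_cons] at hm ⊢
          omega)
        simpa using this
      have ha' := hs a ha
      have hb' := hs b hb
      -- The quadric, solved for `h a * h b`: every term on the right has larger total rank, because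
      -- `a` and `b` are incomparable.
      have e : h a * (h b * (u.map h).prod) = h a * (h (a ⊔ b) * (u.map h).prod) +
          h (a ⊔ b) * (h b * (u.map h).prod) - h (a ⊔ b) * (h (a ⊔ b) * (u.map h).prod) := by
        linear_combination (u.map h).prod * hh.quadric a b
      simp only [Multiset.map_cons, Multiset.prod_cons, Multiset.card_cons]
      rw [e]
      exact sub_mem (add_mem (main _ _ ha' hJ (by omega)) (main _ _ hJ hb' (by omega)))
        (main _ _ hJ hJ (by omega))

end IsChowFamily

end Nested

/-! ### Degree functions of intervals, as functionals on the Chow relations. -/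

section Functionals

variable {L : Type*} [Lattice L] [BoundedOrder L] {r : L → ℕ}

/-- A function on multisets that extends to a linear functional vanishing on the relations of the
Chow ring. -/
structure IsChowFunctional (r : L → ℕ) (f : Multiset L → ℤ) : Prop where
  quadric : ∀ a b u, f (a ::ₘ b ::ₘ u) + f ((a ⊔ b) ::ₘ (a ⊔ b) ::ₘ u) =
    f (a ::ₘ (a ⊔ b) ::ₘ u) + f ((a ⊔ b) ::ₘ b ::ₘ u)
  atom : ∀ i u, r i = 1 → f (i ::ₘ u) = 0

/-- The dragon Hall–Rado condition relative to the element `c`. -/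
def HallRado (r : L → ℕ) (c : L) (u : Multiset L) : Prop :=
  ∀ w ≤ u, w ≠ 0 → w.card + 1 + r c ≤ r (w.sup ⊔ c)

theorem hallRado_cons {c a : L} {u : Multiset L} :
    HallRado r c (a ::ₘ u) ↔
      HallRado r c u ∧ ∀ w ≤ u, w.card + 2 + r c ≤ r (a ⊔ (w.sup ⊔ c)) := by
  constructor
  · refine fun h => ⟨fun w hw => h w (hw.trans (Multiset.le_cons_self u a)), fun w hw => ?_⟩
    have := h (a ::ₘ w) ((Multiset.cons_le_cons_iff a).2 hw) (Multiset.cons_ne_zero)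
    rw [Multiset.card_cons, Multiset.sup_cons, sup_assoc] at this
    omega
  · rintro ⟨h1, h2⟩ w hw h0
    by_cases ha : a ∈ w
    · obtain ⟨w, rfl⟩ := Multiset.exists_cons_of_mem ha
      have := h2 w ((Multiset.cons_le_cons_iff a).1 hw)
      rw [Multiset.card_cons, Multiset.sup_cons, sup_assoc]
      omega
    · exact h1 w ((Multiset.le_cons_of_notMem ha).1 hw) h0

open scoped Classical in
/-- The degree function of the interval `[c, v]`. -/
noncomputable def intervalDegree (r : L → ℕ) (c v : L) (u : Multiset L) : ℤ :=
  if (u.card + 1 + r c = r v ∧ ∀ a ∈ u, a ≤ v) ∧ HallRado r c u then 1 else 0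

/-- The cardinality and boundedness conditions agree in all four terms, so only the Hall–Rado
indicators matter. With `S x` the condition on submultisets using `x` and elements of `u`, the claim
becomes `[S a ∧ S b] + [S (a ⊔ b)] = [S a] + [S b]`. Since `S a` and `S b` each imply `S (a ⊔ b)`,
it remains to exclude that both fail. -/
theorem intervalDegree_quadric (hr : IsGeometricRank r) (c v a b : L) (u : Multiset L) :
    intervalDegree r c v (a ::ₘ b ::ₘ u) + intervalDegree r c v ((a ⊔ b) ::ₘ (a ⊔ b) ::ₘ u) =
      intervalDegree r c v (a ::ₘ (a ⊔ b) ::ₘ u) +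
        intervalDegree r c v ((a ⊔ b) ::ₘ b ::ₘ u) := by
  classical
  have mono := hr.strictMono.monotone
  have E1 : ∀ x, a ⊔ ((b ⊔ x)) = (a ⊔ b) ⊔ x := fun x => (sup_assoc _ _ _).symm
  have E2 : ∀ x, a ⊔ ((a ⊔ b) ⊔ x) = (a ⊔ b) ⊔ x := fun x => by
    rw [← sup_assoc, ← sup_assoc, sup_idem]
  have E3 : ∀ x, (a ⊔ b) ⊔ (b ⊔ x) = (a ⊔ b) ⊔ x := fun x => by
    rw [← sup_assoc, sup_assoc a, sup_idem]
  have E4 : ∀ x, (a ⊔ b) ⊔ ((a ⊔ b) ⊔ x) = (a ⊔ b) ⊔ x := fun x => by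
    rw [← sup_assoc, sup_idem]
  have card : ∀ x y : L, (x ::ₘ y ::ₘ u).card = u.card + 2 := by simp
  set S : L → Prop := fun x => ∀ w ≤ u, w.card + 2 + r c ≤ r (x ⊔ (w.sup ⊔ c)) with hS
  -- Submultisets using both new elements give the same condition for all four pairs, as each pair
  -- has join `a ⊔ b`.
  have hall : ∀ x y, (∀ z, x ⊔ (y ⊔ z) = (a ⊔ b) ⊔ z) →
      (HallRado r c (x ::ₘ y ::ₘ u) ↔ HallRado r c u ∧ S y ∧ S x ∧
        ∀ w ≤ u, w.card + 3 + r c ≤ r ((a ⊔ b) ⊔ (w.sup ⊔ c))) := by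
    intro x y hxy
    rw [hallRado_cons, hallRado_cons, and_assoc]
    refine and_congr_right fun _ => and_congr_right fun hy => ?_
    constructor
    · intro hx
      refine ⟨fun w hw => hx w (hw.trans (Multiset.le_cons_self _ _)), fun w hw => ?_⟩
      have := hx (y ::ₘ w) ((Multiset.cons_le_cons_iff y).2 hw)
      rw [Multiset.card_cons, Multiset.sup_cons, sup_assoc, hxy] at this
      omega
    · rintro ⟨hx, hj⟩ w hw
      by_cases hy' : y ∈ w
      · obtain ⟨w, rfl⟩ := Multiset.exists_cons_of_mem hy'
        have := hj w ((Multiset.cons_le_cons_iff y).1 hw)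
        rw [Multiset.card_cons, Multiset.sup_cons, sup_assoc, hxy]
        omega
      · exact hx w ((Multiset.le_cons_of_notMem hy').1 hw)
  have le : ∀ x y, (x ⊔ y = a ⊔ b) → ((∀ z ∈ x ::ₘ y ::ₘ u, z ≤ v) ↔
      (a ⊔ b ≤ v ∧ ∀ z ∈ u, z ≤ v)) := by
    intro x y hxy
    rw [← hxy]
    simp [and_assoc]
  have Sa : S a → S (a ⊔ b) := fun h w hw =>
    (h w hw).trans (mono (sup_le_sup_right le_sup_left _))
  have Sb : S b → S (a ⊔ b) := fun h w hw =>
    (h w hw).trans (mono (sup_le_sup_right le_sup_right _))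
  -- Uncrossing: if `w₁` and `w₂` witness the failure of `S a` and `S b`, submodularity bounds the
  -- ranks attached to `w₁ ∪ w₂` (with `a ⊔ b`) and `w₁ ∩ w₂` more tightly than the Hall–Rado
  -- conditions allow.
  have key : HallRado r c u → (∀ w ≤ u, w.card + 3 + r c ≤ r ((a ⊔ b) ⊔ (w.sup ⊔ c))) →
      S a ∨ S b := by
    intro hu hj
    by_contra! hcon
    simp only [hS] at hcon
    push Not at hcon
    obtain ⟨⟨w₁, hw₁, h₁⟩, w₂, hw₂, h₂⟩ := hcon
    have sub := hr.submodular (a ⊔ (w₁.sup ⊔ c)) (b ⊔ (w₂.sup ⊔ c))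
    have e : a ⊔ (w₁.sup ⊔ c) ⊔ (b ⊔ (w₂.sup ⊔ c)) = (a ⊔ b) ⊔ ((w₁ ∪ w₂).sup ⊔ c) := by
      rw [Multiset.sup_union, sup_sup_sup_comm a, sup_sup_sup_comm w₁.sup, sup_idem]
    have hcup := hj (w₁ ∪ w₂) (Multiset.union_le hw₁ hw₂)
    have hcard := congrArg Multiset.card (Multiset.union_add_inter w₁ w₂)
    rw [Multiset.card_add, Multiset.card_add] at hcard
    have hinf : r ((w₁ ∩ w₂).sup ⊔ c) ≤ r ((a ⊔ (w₁.sup ⊔ c)) ⊓ (b ⊔ (w₂.sup ⊔ c))) :=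
      mono (le_inf
        (le_sup_of_le_right (sup_le_sup_right
          (Multiset.sup_mono (Multiset.subset_of_le (Multiset.inter_le_left))) c))
        (le_sup_of_le_right (sup_le_sup_right
          (Multiset.sup_mono (Multiset.subset_of_le (Multiset.inter_le_right))) c)))
    rw [e] at sub
    by_cases h0 : w₁ ∩ w₂ = 0
    · rw [h0] at hcard hinf
      rw [Multiset.card_zero] at hcard
      rw [Multiset.sup_zero, bot_sup_eq] at hinf
      omega
    · have := hu (w₁ ∩ w₂) (Multiset.inter_le_left.trans hw₁) h0
      omega
  unfold intervalDegree
  rw [hall a b E1, hall a (a ⊔ b) E2, hall (a ⊔ b) b E3, hall (a ⊔ b) (a ⊔ b) E4,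
    card, card, card, card]
  simp only [le a b rfl, le a (a ⊔ b) (by simp), le (a ⊔ b) b (by simp),
    le (a ⊔ b) (a ⊔ b) (by simp)]
  by_cases h1 : (u.card + 2 + 1 + r c = r v ∧ a ⊔ b ≤ v ∧ ∀ z ∈ u, z ≤ v)
  swap
  · simp only [h1, false_and, if_false]
  by_cases h2 : HallRado r c u
  swap
  · simp [h2]
  by_cases h3 : ∀ w ≤ u, w.card + 3 + r c ≤ r ((a ⊔ b) ⊔ (w.sup ⊔ c))
  swap
  · simp only [h3, and_false, if_false]
  have := key h2 h3
  simp only [h1, h2, true_and]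
  by_cases ha : S a <;> by_cases hb : S b
  · simp [ha, hb, Sa ha]
  · simp [ha, hb, Sa ha]
  · simp [ha, hb, Sb hb]
  · simp [ha, hb] at this

/-- The interval `[c, v]` sees an element only through its join with `c`. -/
theorem intervalDegree_congr {c v a b : L} (hc : c ≤ v) (h : a ⊔ c = b ⊔ c) (u : Multiset L) :
    intervalDegree r c v (a ::ₘ u) = intervalDegree r c v (b ::ₘ u) := by
  have h1 : a ≤ v ↔ b ≤ v := by
    have ha : a ⊔ c ≤ v ↔ a ≤ v := by simp [hc]
    have hb : b ⊔ c ≤ v ↔ b ≤ v := by simp [hc]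
    rw [← ha, ← hb, h]
  have h2 : ∀ x, a ⊔ (x ⊔ c) = b ⊔ (x ⊔ c) := fun x => by
    rw [sup_comm x, ← sup_assoc, ← sup_assoc, h]
  have h3 : ((a ::ₘ u).card + 1 + r c = r v ∧ ∀ x ∈ a ::ₘ u, x ≤ v) ∧ HallRado r c (a ::ₘ u) ↔
      ((b ::ₘ u).card + 1 + r c = r v ∧ ∀ x ∈ b ::ₘ u, x ≤ v) ∧ HallRado r c (b ::ₘ u) := by
    rw [hallRado_cons, hallRado_cons]
    simp only [h2, Multiset.card_cons, Multiset.mem_cons, forall_eq_or_imp, h1]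
  unfold intervalDegree
  by_cases h4 : ((b ::ₘ u).card + 1 + r c = r v ∧ ∀ x ∈ b ::ₘ u, x ≤ v) ∧ HallRado r c (b ::ₘ u)
  · rw [if_pos h4, if_pos (h3.2 h4)]
  · rw [if_neg h4, if_neg (fun h => h4 (h3.1 h))]

/-- The singleton `{i}` would need `r (i ⊔ c) ≥ r c + 2`, while submodularity allows at most `r c +
1`. -/
theorem intervalDegree_atom (hr : IsGeometricRank r) {c v i : L} (hi : r i = 1)
    (u : Multiset L) : intervalDegree r c v (i ::ₘ u) = 0 := by
  unfold intervalDegree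
  rw [if_neg]
  rintro ⟨-, h⟩
  have := (hallRado_cons.1 h).2 0 (Multiset.zero_le u)
  rw [Multiset.card_zero, Multiset.sup_zero, bot_sup_eq] at this
  have := hr.submodular i c
  omega

theorem intervalDegree_replicate {c v : L} {n : ℕ} (hc : c ≤ v) (hn : n + 1 + r c = r v) :
    intervalDegree r c v (Multiset.replicate n v) = 1 := by
  unfold intervalDegree
  rw [if_pos]
  refine ⟨⟨by simpa using hn, fun a ha => (Multiset.eq_of_mem_replicate ha).le⟩, ?_⟩
  intro w hw h0
  have h1 := Multiset.card_le_card hw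
  rw [Multiset.card_replicate] at h1
  obtain ⟨a, ha⟩ := Multiset.exists_mem_of_ne_zero h0
  obtain rfl := Multiset.eq_of_mem_replicate (Multiset.mem_of_le hw ha)
  have : w.sup ⊔ c = a := le_antisymm (sup_le (Multiset.sup_le.2 fun b hb =>
    (Multiset.eq_of_mem_replicate (Multiset.mem_of_le hw hb)).le) hc)
    (le_sup_of_le_left (Multiset.le_sup ha))
  rw [this]
  omega

open scoped Classical in
-- Elements below `c` are evaluated by `f`, the others in `[c, v]`. If exactly one of `a`, `b` lies
-- below `c`, the other one and `a ⊔ b` have the same join with `c`, so the four terms of the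
-- quadric cancel in pairs.
theorem IsChowFunctional.mul_intervalDegree (hr : IsGeometricRank r) {f : Multiset L → ℤ}
    (hf : IsChowFunctional r f) {c v : L} (hc : c ≤ v) :
    IsChowFunctional r fun t =>
      f (t.filter (· ≤ c)) * intervalDegree r c v (t.filter (¬ · ≤ c)) where
  quadric a b u := by
    by_cases ha : a ≤ c <;> by_cases hb : b ≤ c
    · have hJ : a ⊔ b ≤ c := sup_le ha hb
      simp only [Multiset.filter_cons_of_pos, Multiset.filter_cons_of_neg, ha, hb, hJ,
        not_true_eq_false, not_false_eq_true, ← add_mul, hf.quadric]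
    · have hJ : ¬ a ⊔ b ≤ c := fun h => hb (le_sup_right.trans h)
      have e : b ⊔ c = (a ⊔ b) ⊔ c := by
        rw [sup_comm a, sup_assoc, sup_eq_right.2 ha]
      simp only [Multiset.filter_cons_of_pos, Multiset.filter_cons_of_neg, ha, hb, hJ,
        not_true_eq_false, not_false_eq_true]
      rw [Multiset.cons_swap (a ⊔ b) b]
      simp only [intervalDegree_congr hc e]
    · have hJ : ¬ a ⊔ b ≤ c := fun h => ha (le_sup_left.trans h)
      have e : a ⊔ c = (a ⊔ b) ⊔ c := by
        rw [sup_assoc, sup_eq_right.2 hb]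
      simp only [Multiset.filter_cons_of_pos, Multiset.filter_cons_of_neg, ha, hb, hJ,
        not_true_eq_false, not_false_eq_true]
      simp only [intervalDegree_congr hc e]
      ring
    · have hJ : ¬ a ⊔ b ≤ c := fun h => ha (le_sup_left.trans h)
      simp only [Multiset.filter_cons_of_pos, Multiset.filter_cons_of_neg, ha, hb, hJ,
        not_false_eq_true, ← mul_add, intervalDegree_quadric hr]
  atom i u hi := by
    by_cases h : i ≤ c
    · simp [h, hf.atom _ _ hi]
    · simp [h, intervalDegree_atom hr hi]

theorem IsGeometricRank.exists_between (hr : IsGeometricRank r) (m : ℕ) (a b : L) (hab : a ≤ b)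
    (ha : r a ≤ m) (hb : m ≤ r b) : ∃ c, a ≤ c ∧ c ≤ b ∧ r c = m := by
  induction m, ha using Nat.le_induction with
  | base => exact ⟨a, le_rfl, hab, rfl⟩
  | succ m _ ih =>
    obtain ⟨c, hac, hcb, hc⟩ := ih (by omega)
    obtain ⟨i, hi, hib, hic⟩ := hr.exists_atom c b (lt_of_le_of_ne hcb (by rintro rfl; omega))
    exact ⟨c ⊔ i, hac.trans le_sup_left, sup_le hcb hib, by rw [hr.rank_sup_atom hi hic, hc]⟩

end Functionals

/-! ### Peeling off the top element, and triangular dual functionals. -/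

section Peel

theorem Multiset.eq_replicate_or_sum_lt {L : Type*} [PartialOrder L] {r : L → ℕ} (hr : StrictMono r) {v : L} (t : Multiset L)
    (ht : ∀ a ∈ t, a ≤ v) :
    t = Multiset.replicate t.card v ∨ (t.map r).sum < t.card * r v := by
  induction t using Multiset.induction with
  | empty => simp
  | cons a t ih =>
    have hm := Multiset.sum_le_card_nsmul (t.map r) (r v) (by
      intro x hx
      obtain ⟨b, hb, rfl⟩ := Multiset.mem_map.1 hx
      exact hr.monotone (ht b (Multiset.mem_cons_of_mem hb)))
    rw [Multiset.card_map, smul_eq_mul] at hm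
    rw [Multiset.card_cons, Multiset.map_cons, Multiset.sum_cons, add_mul, one_mul]
    obtain rfl | hlt := (ht a (Multiset.mem_cons_self a t)).eq_or_lt
    · rcases ih fun b hb => ht b (Multiset.mem_cons_of_mem hb) with h | h
      · left
        rw [Multiset.replicate_succ, ← h]
      · right
        omega
    · have := hr hlt
      right
      omega

variable {L : Type*} [Lattice L] [BoundedOrder L] {r : L → ℕ}

theorem IsNested.mono {s t : Multiset L} (hs : IsNested r s) (h : t ≤ s) : IsNested r t := by
  classical
  have sub := Multiset.subset_of_le h
  refine ⟨fun a ha => hs.1 a (sub ha), fun a ha b hb => hs.2.1 a (sub ha) b (sub hb),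
    fun a ha b hb hba => ?_⟩
  have h1 := hs.2.2 a (sub ha) b (hb.imp_right fun h => sub h) hba
  have h2 := Multiset.count_le_of_le a h
  convert lt_of_le_of_lt (Nat.add_le_add_right h2 (r b)) h1 using 3

theorem Multiset.sup_mem_of_chain {s : Multiset L} (hs : ∀ a ∈ s, ∀ b ∈ s, a ≤ b ∨ b ≤ a)
    (h0 : s ≠ 0) : s.sup ∈ s := by
  induction s using Multiset.induction with
  | empty => exact absurd rfl h0
  | cons a s ih =>
    by_cases h : s = 0
    · simp [h]
    have := ih (fun a ha b hb => hs a (Multiset.mem_cons_of_mem ha) b (Multiset.mem_cons_of_mem hb)) h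
    rw [Multiset.sup_cons]
    rcases hs a (Multiset.mem_cons_self a s) _ (Multiset.mem_cons_of_mem this) with h | h
    · rw [sup_eq_right.2 h]
      exact Multiset.mem_cons_of_mem this
    · rw [sup_eq_left.2 h]
      exact Multiset.mem_cons_self a s

theorem IsNested.sup_mem {s : Multiset L} (hs : IsNested r s) (h0 : s ≠ 0) : s.sup ∈ s :=
  Multiset.sup_mem_of_chain hs.2.1 h0

theorem IsNested.eq_zero_of_sup {s : Multiset L} (hs : IsNested r s) (h : s.sup = ⊥) : s = 0 := by
  by_contra h0
  exact hs.1 _ (hs.sup_mem h0) h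

open scoped Classical in
/-- Removing all copies of the largest element from a nested multiset. -/
theorem IsNested.peel {s : Multiset L} (hs : IsNested r s) {v : L} (hv : s.sup = v)
    (h0 : v ≠ ⊥) :
    IsNested r (s.filter (· ≠ v)) ∧ (s.filter (· ≠ v)).sup < v ∧ 1 ≤ s.count v ∧
      s.count v + r (s.filter (· ≠ v)).sup < r v ∧
      s = s.filter (· ≠ v) + Multiset.replicate (s.count v) v := by
  have hn : s ≠ 0 := by
    rintro rfl
    exact h0 (by simpa using hv.symm)
  have hmem : v ∈ s := hv ▸ hs.sup_mem hn
  have hle : ∀ a ∈ s, a ≤ v := fun a ha => hv ▸ Multiset.le_sup ha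
  have h1 : IsNested r (s.filter (· ≠ v)) := hs.mono (Multiset.filter_le _ _)
  have h2 : (s.filter (· ≠ v)).sup = ⊥ ∨ (s.filter (· ≠ v)).sup ∈ s.filter (· ≠ v) := by
    by_cases h : s.filter (· ≠ v) = 0
    · left
      rw [h, Multiset.sup_zero]
    · exact Or.inr (h1.sup_mem h)
  have h3 : (s.filter (· ≠ v)).sup < v := by
    rcases h2 with h | h
    · rw [h]
      exact bot_lt_iff_ne_bot.2 h0
    · rw [Multiset.mem_filter] at h
      exact lt_of_le_of_ne (hle _ h.1) h.2
  refine ⟨h1, h3, Multiset.one_le_count_iff_mem.2 hmem, ?_, ?_⟩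
  · convert hs.2.2 v hmem _ (h2.imp_right fun h => (Multiset.mem_filter.1 h).1) h3
  · conv_lhs => rw [← Multiset.filter_add_not (· ≠ v) s]
    congr 1
    rw [← Multiset.filter_eq']
    exact Multiset.filter_congr (by simp)

theorem IsNested.add_replicate {s : Multiset L} (hr : IsGeometricRank r) (hs : IsNested r s) {v : L}
    (hlt : s.sup < v) {n : ℕ} (hn : n + r s.sup < r v) :
    IsNested r (s + Multiset.replicate n v) := by
  classical
  have hle : ∀ a ∈ s, a < v := fun a ha => (Multiset.le_sup ha).trans_lt hlt
  have hv : v ∉ s := fun h => (hle v h).false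
  have cases : ∀ a ∈ s + Multiset.replicate n v, a ∈ s ∨ a = v := fun a ha =>
    (Multiset.mem_add.1 ha).imp_right Multiset.eq_of_mem_replicate
  refine ⟨fun a ha => ?_, fun a ha b hb => ?_, fun a ha b hb hba => ?_⟩
  · rcases cases a ha with h | rfl
    · exact hs.1 a h
    · exact (bot_le.trans_lt hlt).ne'
  · rcases cases a ha with h | rfl <;> rcases cases b hb with h' | rfl
    · exact hs.2.1 a h b h'
    · exact Or.inl (hle _ h).le
    · exact Or.inr (hle _ h').le
    · exact Or.inl le_rfl
  · rw [Multiset.count_add, Multiset.count_replicate]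
    rcases cases a ha with h | rfl
    · rw [if_neg (hle a h).ne', add_zero]
      have hb' : b = ⊥ ∨ b ∈ s := by
        refine hb.imp_right fun hb => (cases b hb).resolve_right ?_
        rintro rfl
        exact (hba.trans (hle a h)).false
      convert hs.2.2 a h b hb' hba
    · rw [Multiset.count_eq_zero_of_notMem hv, if_pos rfl]
      have : b ≤ s.sup := by
        rcases hb with rfl | hb
        · exact bot_le
        · exact Multiset.le_sup ((cases b hb).resolve_right hba.ne)
      have := hr.strictMono.monotone this
      omega

/-- The functional dual to a nested monomial, up to monomials of smaller total rank. -/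
theorem IsNested.exists_functional (hr : IsGeometricRank r) (n : ℕ) (s : Multiset L)
    (hn : s.card ≤ n) (hs : IsNested r s) :
    ∃ f, IsChowFunctional r f ∧ f s = 1 ∧ ∀ t, f t ≠ 0 → t.card = s.card ∧
      (∀ a ∈ t, a ≤ s.sup) ∧ (t = s ∨ (t.map r).sum < (s.map r).sum) := by
  classical
  induction n generalizing s with
  | zero =>
    obtain rfl := Multiset.card_eq_zero.1 (Nat.le_zero.1 hn)
    refine ⟨fun t => if t = 0 then 1 else 0, ⟨by simp, by simp⟩, by simp, fun t ht => ?_⟩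
    have : t = 0 := by
      by_contra h
      simp [h] at ht
    simp [this]
  | succ n ih =>
    by_cases h0 : s = 0
    · exact ih s (by simp [h0]) hs
    have hbot : s.sup ≠ ⊥ := fun h => h0 (hs.eq_zero_of_sup h)
    obtain ⟨v, hv⟩ : ∃ v, s.sup = v := ⟨_, rfl⟩
    rw [hv] at hbot
    obtain ⟨h1, h2, h3, h4, h5⟩ := hs.peel hv hbot
    generalize s.filter (· ≠ v) = s' at h1 h2 h4 h5
    generalize s.count v = k at h3 h4 h5
    subst h5
    rw [hv]
    rw [Multiset.card_add, Multiset.card_replicate] at hn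
    obtain ⟨f, hf, hfs, hft⟩ := ih s' (by omega) h1
    -- The rank of `c` is chosen so that the degree function of `[c, v]` detects exactly `k`
    -- factors. Nestedness says that `r v - k - 1` is at least the rank of the remaining supremum.
    obtain ⟨c, hc1, hc2, hc⟩ := hr.exists_between (r v - k - 1) s'.sup v h2.le (by omega) (by omega)
    have hvc : ¬ v ≤ c := fun h => by
      have := hr.strictMono.monotone h
      omega
    have hle : ∀ a ∈ s', a ≤ c := fun a ha => (Multiset.le_sup ha).trans hc1
    refine ⟨_, hf.mul_intervalDegree hr hc2, ?_, fun t ht => ?_⟩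
    · have e1 : (s' + Multiset.replicate k v).filter (· ≤ c) = s' := by
        rw [Multiset.filter_add, Multiset.filter_eq_self.2 hle, Multiset.filter_eq_nil.2, add_zero]
        intro a ha
        rwa [Multiset.eq_of_mem_replicate ha]
      have e2 : (s' + Multiset.replicate k v).filter (¬ · ≤ c) = Multiset.replicate k v := by
        rw [Multiset.filter_add, Multiset.filter_eq_nil.2 (fun a ha => not_not.2 (hle a ha)),
          zero_add, Multiset.filter_eq_self]
        intro a ha
        rwa [Multiset.eq_of_mem_replicate ha]
      simp only [e1, e2, hfs, one_mul]
      exact intervalDegree_replicate hc2 (by omega)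
    · obtain ⟨g1, g2⟩ := mul_ne_zero_iff.1 ht
      obtain ⟨t1, t2, t3⟩ := hft _ g1
      unfold intervalDegree at g2
      simp only [ne_eq, ite_eq_right_iff, one_ne_zero, imp_false, not_not] at g2
      obtain ⟨⟨u1, u2⟩, -⟩ := g2
      have hsplit := Multiset.filter_add_not (· ≤ c) t
      generalize t.filter (· ≤ c) = t' at *
      generalize t.filter (¬ · ≤ c) = t'' at *
      have hk : t''.card = k := by omega
      rw [← hsplit]
      refine ⟨by simp [t1, hk], fun a ha => ?_, ?_⟩
      · rcases Multiset.mem_add.1 ha with h | h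
        · exact (t2 a h).trans h2.le
        · exact u2 a h
      -- Neither part of `t` exceeds the corresponding part of `s` in total rank, and equality in
      -- both forces `t = s`.
      · have hd := Multiset.eq_replicate_or_sum_lt hr.strictMono t'' u2
        rw [hk] at hd
        simp only [Multiset.map_add, Multiset.sum_add, Multiset.map_replicate,
          Multiset.sum_replicate, smul_eq_mul]
        rcases t3 with rfl | t3 <;> rcases hd with rfl | hd
        · exact Or.inl rfl
        · right; omega
        · right
          simp only [Multiset.map_replicate, Multiset.sum_replicate, smul_eq_mul]
          omega
        · right; omega

end Peel

/-! ### Linear independence of the nested monomials. -/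

section Independence

variable {L : Type*} [Lattice L] {r : L → ℕ}

open MvPolynomial

/-- The ideal of relations of the Chow ring in terms of the generators `h a`. -/
noncomputable def quadricIdeal (r : L → ℕ) : Ideal (MvPolynomial L ℤ) :=
  Ideal.span ({p | ∃ a b, p = (X a - X (a ⊔ b)) * (X b - X (a ⊔ b))} ∪
    {p | ∃ i, r i = 1 ∧ p = X i})

theorem isChowFamily_quadricIdeal (r : L → ℕ) :
    IsChowFamily r fun a => Ideal.Quotient.mk (quadricIdeal r) (X a) where
  quadric a b := by
    rw [← map_sub, ← map_sub, ← map_mul, Ideal.Quotient.eq_zero_iff_mem]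
    exact Ideal.subset_span (Or.inl ⟨a, b, rfl⟩)
  atom i hi := Ideal.Quotient.eq_zero_iff_mem.2 (Ideal.subset_span (Or.inr ⟨i, hi, rfl⟩))

theorem MvPolynomial.prod_map_X_eq_monomial {σ R : Type*} [CommSemiring R] [DecidableEq σ]
    (u : Multiset σ) :
    (u.map X).prod = monomial (Multiset.toFinsupp u) (1 : R) := by
  induction u using Multiset.induction with
  | empty => simp
  | cons a u ih =>
    rw [Multiset.map_cons, Multiset.prod_cons, ih, X, monomial_mul, ← Multiset.singleton_add,
      map_add, Multiset.toFinsupp_singleton, one_mul]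

theorem MvPolynomial.span_prod_map_X (σ R : Type*) [CommSemiring R] :
    Submodule.span R (Set.range fun u : Multiset σ => (u.map (X : σ → MvPolynomial σ R)).prod) =
      ⊤ := by
  classical
  rw [eq_top_iff, ← (basisMonomials σ R).span_eq, Submodule.span_le]
  rintro _ ⟨m, rfl⟩
  refine Submodule.subset_span ⟨Finsupp.toMultiset m, ?_⟩
  simp [prod_map_X_eq_monomial]

/-- The linear functional on polynomials with prescribed values on the monomials. -/
noncomputable def monomialFunctional {σ : Type*} (f : Multiset σ → ℤ) : MvPolynomial σ ℤ →ₗ[ℤ] ℤ :=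
  (basisMonomials σ ℤ).constr ℤ fun m => f (Finsupp.toMultiset m)

theorem monomialFunctional_prod {σ : Type*} (f : Multiset σ → ℤ) (u : Multiset σ) :
    monomialFunctional f (u.map X).prod = f u := by
  classical
  have e : monomial (Multiset.toFinsupp u) (1 : ℤ) =
      basisMonomials σ ℤ (Multiset.toFinsupp u) := by
    rw [MvPolynomial.coe_basisMonomials]
  rw [prod_map_X_eq_monomial, e, monomialFunctional, Module.Basis.constr_basis,
    Multiset.toFinsupp_toMultiset]

theorem IsChowFunctional.eq_zero_of_mem {f : Multiset L → ℤ} (hf : IsChowFunctional r f)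
    {p : MvPolynomial L ℤ} (hp : p ∈ quadricIdeal r) : monomialFunctional f p = 0 := by
  have key : ∀ p ∈ ({p | ∃ a b, p = (X a - X (a ⊔ b)) * (X b - X (a ⊔ b))} ∪
      {p | ∃ i, r i = 1 ∧ p = X i} : Set (MvPolynomial L ℤ)), ∀ q,
      monomialFunctional f (q * p) = 0 := by
    intro p hp q
    have hq : q ∈ Submodule.span ℤ
        (Set.range fun u : Multiset L => (u.map (X : L → MvPolynomial L ℤ)).prod) := by
      rw [span_prod_map_X]
      trivial
    induction hq using Submodule.span_induction with
    | mem x hx =>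
      obtain ⟨u, rfl⟩ := hx
      rcases hp with ⟨a, b, rfl⟩ | ⟨i, hi, rfl⟩
      · have e : (u.map (X : L → MvPolynomial L ℤ)).prod *
            ((X a - X (a ⊔ b)) * (X b - X (a ⊔ b))) =
            ((a ::ₘ b ::ₘ u).map X).prod + (((a ⊔ b) ::ₘ (a ⊔ b) ::ₘ u).map X).prod -
            (((a ::ₘ (a ⊔ b) ::ₘ u).map X).prod + (((a ⊔ b) ::ₘ b ::ₘ u).map X).prod) := by
          simp only [Multiset.map_cons, Multiset.prod_cons]
          ring
        simp only [e, map_sub, map_add, monomialFunctional_prod]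
        rw [hf.quadric, sub_self]
      · have e : (u.map (X : L → MvPolynomial L ℤ)).prod * X i = ((i ::ₘ u).map X).prod := by
          rw [Multiset.map_cons, Multiset.prod_cons, mul_comm]
        simp only [e, monomialFunctional_prod, hf.atom i u hi]
    | zero => simp
    | add x y _ _ hx hy => rw [add_mul, map_add, hx, hy, add_zero]
    | smul c x _ hx => rw [smul_mul_assoc, map_smul, hx, smul_zero]
  have : ∀ q, monomialFunctional f (q * p) = 0 := by
    induction hp using Submodule.span_induction with
    | mem x hx => exact key x hx
    | zero => simp
    | add x y _ _ hx hy => intro q; rw [mul_add, map_add, hx, hy, add_zero]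
    | smul c x _ hx => intro q; rw [smul_eq_mul, ← mul_assoc, hx]
  simpa using this 1

/-- In a nontrivial relation take a term of least total rank. Its dual functional kills every other
term, since it sees only that monomial and monomials of smaller rank. -/
theorem linearIndependent_nested_quotient [BoundedOrder L] (hr : IsGeometricRank r) :
    LinearIndependent ℤ fun s : {s : Multiset L // IsNested r s} =>
      (s.1.map fun a => Ideal.Quotient.mk (quadricIdeal r) (X a)).prod := by
  classical
  rw [linearIndependent_iff']
  by_contra! hcon
  obtain ⟨S, g, hsum, s₀, hs₀, hg₀⟩ := hcon
  obtain ⟨s, hs, hmin⟩ := (S.filter (g · ≠ 0)).exists_min_image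
    (fun s => (s.1.map r).sum) ⟨s₀, by simp [hs₀, hg₀]⟩
  rw [Finset.mem_filter] at hs
  obtain ⟨f, hf, hfs, hft⟩ := s.2.exists_functional hr _ s.1 le_rfl
  have h1 : (∑ t ∈ S, g t • (t.1.map (X : L → MvPolynomial L ℤ)).prod) ∈ quadricIdeal r := by
    rw [← Ideal.Quotient.eq_zero_iff_mem, map_sum, ← hsum]
    refine Finset.sum_congr rfl fun t _ => ?_
    rw [map_zsmul, map_multiset_prod, Multiset.map_map]
    rfl
  have h2 := hf.eq_zero_of_mem h1
  rw [map_sum, Finset.sum_eq_single_of_mem s hs.1] at h2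
  · rw [map_smul, monomialFunctional_prod, hfs, smul_eq_mul, mul_one] at h2
    exact hs.2 h2
  · intro t ht hts
    rw [map_smul, monomialFunctional_prod, smul_eq_mul]
    by_contra hne
    obtain ⟨hgt, hne⟩ := mul_ne_zero_iff.1 hne
    have h3 := hmin t (Finset.mem_filter.2 ⟨ht, hgt⟩)
    rcases (hft _ hne).2.2 with h | h
    · exact hts (Subtype.ext h)
    · omega

instance Multiset.finite_card_eq {L : Type*} [Finite L] (p : Multiset L → Prop) (d : ℕ) :
    Finite {s : Multiset L // p s ∧ s.card = d} := by
  classical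
  have := Fintype.ofFinite L
  have : Finite {s : Multiset L // s.card = d} := inferInstanceAs (Finite (Sym L d))
  exact Finite.of_injective
    (fun s : {s : Multiset L // p s ∧ s.card = d} =>
      (⟨s.1, s.2.2⟩ : {s : Multiset L // s.card = d}))
    fun s t h => Subtype.ext (Subtype.mk.inj h)

/-- Independence pulls back along `φ`, so `φ` need not be an isomorphism. Nested multisets avoid
`⊥`, so the value of `φ (h ⊥)` is irrelevant. -/
theorem finrank_nestedSpan [BoundedOrder L] [Finite L] (hr : IsGeometricRank r) {A : Type*} [CommRing A] {h : L → A}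
    (φ : A →+* MvPolynomial L ℤ ⧸ quadricIdeal r)
    (hφ : ∀ a, a ≠ ⊥ → φ (h a) = Ideal.Quotient.mk _ (X a)) (d : ℕ) :
    Module.finrank ℤ (IsChowFamily.nestedSpan r h d) =
      Nat.card {s : Multiset L // IsNested r s ∧ s.card = d} := by
  have := Fintype.ofFinite {s : Multiset L // IsNested r s ∧ s.card = d}
  have hli : LinearIndependent ℤ fun s : {s : Multiset L // IsNested r s ∧ s.card = d} =>
      (s.1.map h).prod := by
    refine LinearIndependent.of_comp φ.toAddMonoidHom.toIntLinearMap ?_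
    have h0 := (linearIndependent_nested_quotient hr).comp
      (fun s : {s : Multiset L // IsNested r s ∧ s.card = d} => ⟨s.1, s.2.1⟩)
      fun s t h => Subtype.ext (Subtype.mk.inj h)
    have e : (φ.toAddMonoidHom.toIntLinearMap ∘
        fun s : {s : Multiset L // IsNested r s ∧ s.card = d} => (s.1.map h).prod) =
        fun s => (s.1.map fun a => Ideal.Quotient.mk (quadricIdeal r) (X a)).prod := by
      funext s
      change φ _ = _
      rw [map_multiset_prod, Multiset.map_map]
      exact congrArg Multiset.prod (Multiset.map_congr rfl fun a ha => hφ a (s.2.1.1 a ha))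
    rw [e]
    exact h0
  rw [Nat.card_eq_fintype_card, ← finrank_span_eq_card hli, IsChowFamily.nestedSpan]
  have e : {p | ∃ s : Multiset L, IsNested r s ∧ s.card = d ∧ p = (s.map h).prod} =
      Set.range fun s : {s : Multiset L // IsNested r s ∧ s.card = d} => (s.1.map h).prod := by
    ext p
    constructor
    · rintro ⟨s, h1, h2, rfl⟩
      exact ⟨⟨s, h1, h2⟩, rfl⟩
    · rintro ⟨s, rfl⟩
      exact ⟨s.1, s.2.1, s.2.2, rfl⟩
  rw [e]

end Independence

/-! ### Passing between the generators `x` and their upper sums. -/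

section ChangeOfGenerators

variable {L : Type*} [Lattice L] [Fintype L] {A : Type*} [CommRing A]

open scoped Classical in
theorem upperSum_sub_upperSum_sup (x : L → A) (a b : L) :
    ∑ c with a ≤ c, x c - ∑ c with a ⊔ b ≤ c, x c = ∑ c with a ≤ c ∧ ¬ b ≤ c, x c := by
  rw [sub_eq_iff_eq_add, ← Finset.sum_filter_add_sum_filter_not _ (b ≤ ·), add_comm,
    Finset.filter_filter, Finset.filter_filter]
  simp only [sup_le_iff]

open scoped Classical in
-- The two differences are sums over `c ≥ a` with `c ≱ b`, and over `d ≥ b` with `d ≱ a`. Any such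
-- `c` and `d` are incomparable.
theorem upperSum_quadric {x : L → A} (hx : ∀ a b, ¬ a ≤ b → ¬ b ≤ a → x a * x b = 0) (a b : L) :
    (∑ c with a ≤ c, x c - ∑ c with a ⊔ b ≤ c, x c) *
      (∑ c with b ≤ c, x c - ∑ c with a ⊔ b ≤ c, x c) = 0 := by
  rw [upperSum_sub_upperSum_sup, sup_comm a b, upperSum_sub_upperSum_sup, Finset.sum_mul_sum]
  refine Finset.sum_eq_zero fun c hc => Finset.sum_eq_zero fun d hd => ?_
  simp only [Finset.mem_filter, Finset.mem_univ, true_and] at hc hd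
  exact hx c d (fun h => hd.2 (hc.1.trans h)) (fun h => hc.2 (hd.1.trans h))

open scoped Classical in
theorem mem_span_upperSum (x : L → A) (a : L) :
    x a ∈ Submodule.span ℤ {y | ∃ b, a ≤ b ∧ y = ∑ c with b ≤ c, x c} := by
  induction a using WellFoundedGT.induction with
  | ind a ih =>
    have e : x a = ∑ c with a ≤ c, x c - ∑ c with a < c, x c := by
      have : Finset.univ.filter (a ≤ ·) = insert a (Finset.univ.filter (a < ·)) := by
        ext c
        simp [le_iff_eq_or_lt, eq_comm]
      rw [this, Finset.sum_insert (by simp)]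
      ring
    rw [e]
    refine sub_mem (Submodule.subset_span ⟨a, le_rfl, rfl⟩) (sum_mem fun c hc => ?_)
    have hc : a < c := by simpa using hc
    refine Submodule.span_mono ?_ (ih c hc)
    rintro y ⟨b, hb, rfl⟩
    exact ⟨b, hc.le.trans hb, rfl⟩

open scoped Classical in
theorem exists_upperSum_eq (h : L → A) : ∃ x : L → A, ∀ a, ∑ c with a ≤ c, x c = h a := by
  refine ⟨(wellFounded_gt (α := L)).fix fun a ih =>
    h a - ∑ c, if hc : a < c then ih c hc else 0, fun a => ?_⟩
  have : Finset.univ.filter (a ≤ ·) = insert a (Finset.univ.filter (a < ·)) := by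
    ext c
    simp [le_iff_eq_or_lt, eq_comm]
  rw [this, Finset.sum_insert (by simp), WellFounded.fix_eq, Finset.sum_filter]
  simp

open scoped Classical in
-- In the expanded quadric all products are of incomparable elements. By induction from the top in
-- both arguments, every one but `x a * x b` vanishes.
theorem mul_eq_zero_of_upperSum_quadric {x h : L → A} (hx : ∀ a, ∑ c with a ≤ c, x c = h a)
    (hh : ∀ a b, (h a - h (a ⊔ b)) * (h b - h (a ⊔ b)) = 0) (a b : L) (hab : ¬ a ≤ b)
    (hba : ¬ b ≤ a) : x a * x b = 0 := by
  induction a using WellFoundedGT.induction generalizing b with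
  | ind a iha =>
    induction b using WellFoundedGT.induction with
    | ind b ihb =>
      have key := hh a b
      rw [← hx, ← hx, ← hx, upperSum_sub_upperSum_sup, sup_comm a b, upperSum_sub_upperSum_sup,
        Finset.sum_mul_sum, Finset.sum_eq_single_of_mem a (by simp [hba]),
        Finset.sum_eq_single_of_mem b (by simp [hab])] at key
      · exact key
      · intro d hd hne
        simp only [Finset.mem_filter, Finset.mem_univ, true_and] at hd
        exact ihb d (lt_of_le_of_ne hd.1 hne.symm) hd.2 fun h => hba (hd.1.trans h)
      · intro c hc hne
        refine Finset.sum_eq_zero fun d hd => ?_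
        simp only [Finset.mem_filter, Finset.mem_univ, true_and] at hc hd
        exact iha c (lt_of_le_of_ne hc.1 hne.symm) d (fun h => hd.2 (hc.1.trans h))
          fun h => hc.2 (hd.1.trans h)

end ChangeOfGenerators

/-! ### Spans of monomials of fixed degree. -/

section ProductSpan

open MvPolynomial

theorem prod_mem_span_of_forall_mem_span {L ι A : Type*} [CommRing A] {p : L → Prop} {h : L → A}
    {y : ι → A} (hy : ∀ i, y i ∈ Submodule.span ℤ {z | ∃ a, p a ∧ z = h a}) (u : Multiset ι) :
    (u.map y).prod ∈ Submodule.span ℤ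
      {z | ∃ s : Multiset L, (∀ a ∈ s, p a) ∧ s.card = u.card ∧ z = (s.map h).prod} := by
  induction u using Multiset.induction with
  | empty => exact Submodule.subset_span ⟨0, by simp⟩
  | cons i u ih =>
    have := Submodule.mul_mem_mul (hy i) ih
    rw [Submodule.span_mul_span] at this
    rw [Multiset.map_cons, Multiset.prod_cons]
    refine Submodule.span_mono ?_ this
    rintro _ ⟨_, ⟨a, ha, rfl⟩, _, ⟨s, hs, hc, rfl⟩, rfl⟩
    refine ⟨a ::ₘ s, ?_, by simp [hc], by simp⟩
    intro b hb
    rcases Multiset.mem_cons.1 hb with rfl | hb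
    · exact ha
    · exact hs b hb

theorem MvPolynomial.IsHomogeneous.mem_span_prod_X {σ : Type*} {p : MvPolynomial σ ℤ} {d : ℕ}
    (hp : p.IsHomogeneous d) :
    p ∈ Submodule.span ℤ {z | ∃ u : Multiset σ, u.card = d ∧ z = (u.map X).prod} := by
  classical
  rw [p.as_sum]
  refine sum_mem fun m hm => ?_
  have hd := hp (mem_support_iff.1 hm)
  rw [← mul_one (coeff m p), ← smul_eq_mul, ← smul_monomial]
  refine Submodule.smul_mem _ _ (Submodule.subset_span ⟨Finsupp.toMultiset m, ?_, ?_⟩)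
  · rw [← hd, Finsupp.card_toMultiset, Finsupp.weight_apply]
    simp [Finsupp.sum]
  · rw [prod_map_X_eq_monomial, Finsupp.toMultiset_toFinsupp]

end ProductSpan

/-! ### The Chow ring of the matroid of a vector space. -/

section VectorSpace

variable (K V : Type*) [Field K] [AddCommGroup V] [Module K V] [Finite V]

open MvPolynomial

theorem isGeometricRank_finrank :
    IsGeometricRank fun W : Submodule K V => Module.finrank K W where
  bot := finrank_bot K V
  strictMono := fun _ _ h => Submodule.finrank_lt_finrank_of_lt h
  submodular a b := (Submodule.finrank_sup_add_finrank_inf_eq a b).le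
  exists_atom a b hab := by
    obtain ⟨x, hxb, hxa⟩ := SetLike.exists_of_lt hab
    refine ⟨Submodule.span K {x}, finrank_span_singleton ?_, ?_, ?_⟩
    · rintro rfl
      exact hxa a.zero_mem
    · rwa [Submodule.span_singleton_le_iff_mem]
    · rwa [Submodule.span_singleton_le_iff_mem]

namespace Matroid

@[simp] theorem ofVectorSpace_ground : (ofVectorSpace K V).E = Set.univ := rfl

theorem ofVectorSpace_indep_iff {I : Set V} :
    (ofVectorSpace K V).Indep I ↔ LinearIndepOn K id I := Iff.rfl

theorem ofVectorSpace_closure (S : Set V) :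
    (ofVectorSpace K V).closure S = Submodule.span K S := by
  have key : ∀ I, (ofVectorSpace K V).Indep I →
      (ofVectorSpace K V).closure I = Submodule.span K I := by
    intro I hI
    ext x
    rw [hI.mem_closure_iff', SetLike.mem_coe, ofVectorSpace_indep_iff,
      linearIndepOn_id_insert_iff]
    have hI' := (ofVectorSpace_indep_iff K V).1 hI
    simp only [ofVectorSpace_ground, Set.mem_univ, hI', true_and]
    refine ⟨fun h => ?_, fun hx h => h hx⟩
    by_contra hx
    exact hx (Submodule.subset_span (h fun h' => absurd h' hx))
  obtain ⟨I, hI⟩ := (ofVectorSpace K V).exists_isBasis S (by simp)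
  rw [← hI.closure_eq_closure, key I hI.indep]
  congr 1
  refine le_antisymm (Submodule.span_mono hI.subset) (Submodule.span_le.2 ?_)
  rw [← key I hI.indep]
  exact hI.subset_closure

theorem ofVectorSpace_isFlat_iff {F : Set V} :
    (ofVectorSpace K V).IsFlat F ↔ (Submodule.span K F : Set V) = F := by
  rw [isFlat_iff_closure_eq, ofVectorSpace_closure]

theorem ofVectorSpace_closure_empty :
    (ofVectorSpace K V).closure ∅ = ((⊥ : Submodule K V) : Set V) := by
  rw [ofVectorSpace_closure, Submodule.span_empty]

theorem ofVectorSpace_isNonloop_iff {x : V} : (ofVectorSpace K V).IsNonloop x ↔ x ≠ 0 := by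
  rw [← indep_singleton, ofVectorSpace_indep_iff, linearIndepOn_singleton_iff, id]

variable {K V}

/-- The linear subspace underlying a flat. -/
def NonbotFlat.toSubmodule (F : (ofVectorSpace K V).NonbotFlat) : Submodule K V :=
  Submodule.span K F.1

/-- The flat given by a nonzero linear subspace. -/
def NonbotFlat.ofSubmodule (W : Submodule K V) (hW : W ≠ ⊥) : (ofVectorSpace K V).NonbotFlat :=
  ⟨W, by rw [ofVectorSpace_isFlat_iff, Submodule.span_eq], by
    rw [ofVectorSpace_closure_empty]
    exact fun h => hW (SetLike.coe_injective h)⟩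

theorem NonbotFlat.coe_toSubmodule (F : (ofVectorSpace K V).NonbotFlat) :
    (F.toSubmodule : Set V) = F.1 :=
  (ofVectorSpace_isFlat_iff K V).1 F.2.1

theorem NonbotFlat.toSubmodule_le_iff (F G : (ofVectorSpace K V).NonbotFlat) :
    F.toSubmodule ≤ G.toSubmodule ↔ F.1 ⊆ G.1 := by
  rw [← SetLike.coe_subset_coe, F.coe_toSubmodule, G.coe_toSubmodule]

theorem NonbotFlat.toSubmodule_ne_bot (F : (ofVectorSpace K V).NonbotFlat) :
    F.toSubmodule ≠ ⊥ := fun h =>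
  F.2.2 (F.coe_toSubmodule.symm.trans (by rw [ofVectorSpace_closure_empty, h]))

theorem NonbotFlat.toSubmodule_injective :
    Function.Injective (NonbotFlat.toSubmodule (K := K) (V := V)) := fun F G h =>
  Subtype.ext (by rw [← F.coe_toSubmodule, ← G.coe_toSubmodule, h])

theorem NonbotFlat.toSubmodule_ofSubmodule (W : Submodule K V) (hW : W ≠ ⊥) :
    (NonbotFlat.ofSubmodule W hW).toSubmodule = W := Submodule.span_eq W

theorem NonbotFlat.ofSubmodule_toSubmodule (F : (ofVectorSpace K V).NonbotFlat) :
    NonbotFlat.ofSubmodule F.toSubmodule F.toSubmodule_ne_bot = F :=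
  NonbotFlat.toSubmodule_injective (NonbotFlat.toSubmodule_ofSubmodule _ _)

open scoped Classical in
theorem map_flatSum [Fintype (Submodule K V)] {B : Type*} [CommRing B]
    (θ : MvPolynomial (ofVectorSpace K V).NonbotFlat ℤ →+* B) (y : Submodule K V → B)
    (hy : ∀ F, θ (X F) = y F.toSubmodule) {i : V} (hi : i ≠ 0) :
    θ ((ofVectorSpace K V).flatSum i) = ∑ W with Submodule.span K {i} ≤ W, y W := by
  have := Fintype.ofFinite (ofVectorSpace K V).NonbotFlat
  rw [flatSum, finsum_eq_sum_of_fintype, map_sum, Finset.sum_filter]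
  refine Fintype.sum_of_injective _ NonbotFlat.toSubmodule_injective _ _ (fun W hW => ?_)
    fun F => ?_
  · refine if_neg fun h => hW ⟨NonbotFlat.ofSubmodule W ?_, NonbotFlat.toSubmodule_ofSubmodule _ _⟩
    rintro rfl
    rw [le_bot_iff, Submodule.span_singleton_eq_bot] at h
    exact hi h
  · rw [finsum_eq_if, ← hy, Submodule.span_singleton_le_iff_mem, ← SetLike.mem_coe,
      F.coe_toSubmodule]
    split_ifs <;> simp

open scoped Classical in
/-- The generator of the Chow ring given by a nonzero subspace. -/
noncomputable def chowGenerator (W : Submodule K V) : (ofVectorSpace K V).ChowRing :=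
  -- The Chow ring has no variable for `⊥`; the value 0 lets sums run over all subspaces.
  if h : W = ⊥ then 0 else Ideal.Quotient.mk _ (X (NonbotFlat.ofSubmodule W h))

theorem chowGenerator_toSubmodule (F : (ofVectorSpace K V).NonbotFlat) :
    chowGenerator F.toSubmodule = Ideal.Quotient.mk _ (X F) := by
  rw [chowGenerator, dif_neg F.toSubmodule_ne_bot, NonbotFlat.ofSubmodule_toSubmodule]

theorem chowGenerator_mul_eq_zero (W U : Submodule K V) (h₁ : ¬ W ≤ U) (h₂ : ¬ U ≤ W) :
    chowGenerator W * chowGenerator U = 0 := by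
  have hW : W ≠ ⊥ := by
    rintro rfl
    exact h₁ bot_le
  have hU : U ≠ ⊥ := by
    rintro rfl
    exact h₂ bot_le
  rw [chowGenerator, chowGenerator, dif_neg hW, dif_neg hU, ← map_mul,
    Ideal.Quotient.eq_zero_iff_mem]
  exact Ideal.mem_sup_left (Ideal.subset_span ⟨_, _, h₁, h₂, rfl⟩)

open scoped Classical in
/-- The generators `∑_{U ≥ W} x_U` of the Chow ring. -/
noncomputable def chowUpperSum [Fintype (Submodule K V)] (W : Submodule K V) :
    (ofVectorSpace K V).ChowRing :=
  ∑ U with W ≤ U, chowGenerator U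

variable [Fintype (Submodule K V)]

/-- The upper sum of a line is the class of the linear form of any nonzero vector on it. -/
theorem isChowFamily_chowUpperSum :
    IsChowFamily (fun W : Submodule K V => Module.finrank K W) chowUpperSum where
  quadric := upperSum_quadric chowGenerator_mul_eq_zero
  atom W hW := by
    obtain ⟨i, hi, h⟩ := finrank_eq_one_iff'.1 hW
    have hi' : (i : V) ≠ 0 := by simpa using hi
    have e : W = Submodule.span K {(i : V)} := by
      refine le_antisymm (fun w hw => ?_) (by simp [Submodule.span_singleton_le_iff_mem])
      obtain ⟨c, hc⟩ := h ⟨w, hw⟩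
      exact Submodule.mem_span_singleton.2 ⟨c, congrArg Subtype.val hc⟩
    rw [chowUpperSum, e, ← map_flatSum (Ideal.Quotient.mk _) chowGenerator
      (fun F => (chowGenerator_toSubmodule F).symm) hi', Ideal.Quotient.eq_zero_iff_mem]
    exact Ideal.mem_sup_right (Ideal.subset_span
      ⟨i, (ofVectorSpace_isNonloop_iff K V).2 hi', rfl⟩)

variable (K V) in
-- Möbius inversion of the generators of the target gives images for the `x_F`. Only the upper sum
-- of `⊥` may go astray, as the inverted element at `⊥` has no counterpart in the Chow ring.
theorem exists_chowRing_hom : ∃ φ : (ofVectorSpace K V).ChowRing →+*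
      MvPolynomial (Submodule K V) ℤ ⧸
        quadricIdeal (fun W : Submodule K V => Module.finrank K W),
    ∀ W, W ≠ ⊥ → φ (chowUpperSum W) = Ideal.Quotient.mk _ (X W) := by
  classical
  have hh := isChowFamily_quadricIdeal (fun W : Submodule K V => Module.finrank K W)
  obtain ⟨y, hy⟩ := exists_upperSum_eq fun W : Submodule K V =>
    Ideal.Quotient.mk (quadricIdeal fun W : Submodule K V => Module.finrank K W) (X W)
  have hy' := mul_eq_zero_of_upperSum_quadric hy hh.quadric
  set θ := eval₂Hom (Int.castRingHom (MvPolynomial (Submodule K V) ℤ ⧸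
    quadricIdeal fun W : Submodule K V => Module.finrank K W))
    fun F : (ofVectorSpace K V).NonbotFlat => y F.toSubmodule with hθ
  have hX : ∀ F, θ (X F) = y F.toSubmodule := fun F => by rw [hθ, eval₂Hom_X']
  have hker : ∀ p ∈ (ofVectorSpace K V).chowIdeal, θ p = 0 := by
    change (ofVectorSpace K V).chowIdeal ≤ RingHom.ker θ
    refine sup_le (Ideal.span_le.2 ?_) (Ideal.span_le.2 ?_)
    · rintro _ ⟨F, G, h₁, h₂, rfl⟩
      rw [SetLike.mem_coe, RingHom.mem_ker, map_mul, hX, hX]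
      exact hy' _ _ (by rwa [NonbotFlat.toSubmodule_le_iff])
        (by rwa [NonbotFlat.toSubmodule_le_iff])
    · rintro _ ⟨i, hi, rfl⟩
      rw [ofVectorSpace_isNonloop_iff] at hi
      rw [SetLike.mem_coe, RingHom.mem_ker, map_flatSum θ y hX hi, hy]
      exact hh.atom _ (finrank_span_singleton hi)
  refine ⟨Ideal.Quotient.lift _ θ hker, fun W hW => ?_⟩
  rw [chowUpperSum, map_sum, ← hy W]
  refine Finset.sum_congr rfl fun U hU => ?_
  have hU : W ≤ U := by simpa using hU
  have hU' : U ≠ ⊥ := fun h => hW (by rwa [h, le_bot_iff] at hU)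
  rw [chowGenerator, dif_neg hU', Ideal.Quotient.lift_mk, hX, NonbotFlat.toSubmodule_ofSubmodule]

theorem chowUpperSum_eq_mk (W : Submodule K V) : ∃ p, p.IsHomogeneous 1 ∧
    chowUpperSum W = Ideal.Quotient.mk (ofVectorSpace K V).chowIdeal p := by
  classical
  choose! p hp using fun U : Submodule K V => show ∃ p, p.IsHomogeneous 1 ∧
      chowGenerator U = Ideal.Quotient.mk (ofVectorSpace K V).chowIdeal p by
    rw [chowGenerator]
    split_ifs with h
    · exact ⟨0, isHomogeneous_zero _ _ _, (map_zero _).symm⟩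
    · exact ⟨_, isHomogeneous_X _ _, rfl⟩
  refine ⟨∑ U with W ≤ U, p U, IsHomogeneous.sum _ _ _ fun U _ => (hp U).1, ?_⟩
  rw [chowUpperSum, map_sum]
  exact Finset.sum_congr rfl fun U _ => (hp U).2

/-- Each `x_F` is an integral combination of upper sums of subspaces containing `F`, hence nonzero.
Products of these are then straightened. -/
theorem chowComponent_eq_nestedSpan (d : ℕ) :
    (ofVectorSpace K V).chowComponent d =
      IsChowFamily.nestedSpan (fun W : Submodule K V => Module.finrank K W) chowUpperSum d := by
  apply le_antisymm
  · rintro _ ⟨p, hp, rfl⟩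
    replace hp := IsHomogeneous.mem_span_prod_X ((mem_homogeneousSubmodule d p).1 hp)
    induction hp using Submodule.span_induction with
    | mem x hx =>
      obtain ⟨u, rfl, rfl⟩ := hx
      have e : (Ideal.Quotient.mkₐ ℤ (ofVectorSpace K V).chowIdeal).toLinearMap (u.map X).prod =
          (u.map fun F => chowGenerator F.toSubmodule).prod := by
        change Ideal.Quotient.mk (ofVectorSpace K V).chowIdeal _ = _
        rw [map_multiset_prod, Multiset.map_map]
        simp only [chowGenerator_toSubmodule, Function.comp_def]
      rw [e]
      have key := prod_mem_span_of_forall_mem_span (p := fun W : Submodule K V => W ≠ ⊥)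
        (h := chowUpperSum)
        (y := fun F : (ofVectorSpace K V).NonbotFlat => chowGenerator F.toSubmodule) (fun F => by
          refine Submodule.span_mono ?_ (mem_span_upperSum chowGenerator F.toSubmodule)
          rintro _ ⟨W, hW, rfl⟩
          refine ⟨W, fun h => F.toSubmodule_ne_bot (by rwa [h, le_bot_iff] at hW), ?_⟩
          rw [chowUpperSum]) u
      refine Submodule.span_le.2 ?_ key
      rintro _ ⟨s, hs, hc, rfl⟩
      rw [← hc]
      exact isChowFamily_chowUpperSum.prod_mem_nestedSpan (isGeometricRank_finrank K V) _ s hs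
        (by omega : _ < _ + (s.card * Module.finrank K (⊤ : Submodule K V) + 1))
    | zero => rw [map_zero]; exact Submodule.zero_mem _
    | add x y _ _ hx hy => rw [map_add]; exact add_mem hx hy
    | smul c x _ hx => rw [map_smul]; exact Submodule.smul_mem _ c hx
  · refine Submodule.span_le.2 ?_
    rintro _ ⟨s, -, rfl, rfl⟩
    choose p hp using chowUpperSum_eq_mk (K := K) (V := V)
    refine ⟨(s.map p).prod, ?_, ?_⟩
    · rw [SetLike.mem_coe, mem_homogeneousSubmodule]
      induction s using Multiset.induction with
      | empty => simpa using isHomogeneous_one _ _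
      | cons W s ih =>
        rw [Multiset.map_cons, Multiset.prod_cons, Multiset.card_cons, add_comm]
        exact (hp W).1.mul ih
    · change Ideal.Quotient.mk (ofVectorSpace K V).chowIdeal _ = _
      rw [map_multiset_prod, Multiset.map_map]
      exact congrArg Multiset.prod (Multiset.map_congr rfl fun W _ => (hp W).2.symm)

theorem finrank_chowComponent (d : ℕ) :
    Module.finrank ℤ ((ofVectorSpace K V).chowComponent d) = Nat.card {s : Multiset (Submodule K V) //
      IsNested (fun W : Submodule K V => Module.finrank K W) s ∧ s.card = d} := by
  obtain ⟨φ, hφ⟩ := exists_chowRing_hom K V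
  rw [chowComponent_eq_nestedSpan]
  exact finrank_nestedSpan (isGeometricRank_finrank K V) φ hφ d

end Matroid

end VectorSpace

/-! ### Counting nested multisets by their supremum. -/

section Counting

variable {L : Type*} [Lattice L] [BoundedOrder L]

/-- The generating function by cardinality of the nested multisets with supremum `v`. -/
noncomputable def nestedSeries (r : L → ℕ) (v : L) : PowerSeries ℚ :=
  PowerSeries.mk fun d => (Nat.card {s : Multiset L // (IsNested r s ∧ s.sup = v) ∧ s.card = d} : ℚ)

variable {r : L → ℕ}

theorem sum_nestedSeries [Fintype L] :
    ∑ v, nestedSeries r v =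
      PowerSeries.mk fun d => (Nat.card {s : Multiset L // IsNested r s ∧ s.card = d} : ℚ) := by
  ext d
  rw [map_sum, PowerSeries.coeff_mk, Nat.card_congr (Equiv.sigmaFiberEquiv
    fun s : {s : Multiset L // IsNested r s ∧ s.card = d} => s.1.sup).symm, Nat.card_sigma,
    Nat.cast_sum]
  refine Finset.sum_congr rfl fun v _ => ?_
  rw [nestedSeries, PowerSeries.coeff_mk, Nat.cast_inj]
  exact Nat.card_congr ((Equiv.subtypeSubtypeEquivSubtypeInter
    (fun s : Multiset L => IsNested r s ∧ s.card = d) (fun s => s.sup = v)).trans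
    (Equiv.subtypeEquivRight fun s => by tauto)).symm

theorem isNested_zero : IsNested r (0 : Multiset L) := by
  simp [IsNested]

theorem nestedSeries_bot : nestedSeries r (⊥ : L) = 1 := by
  ext d
  rw [nestedSeries, PowerSeries.coeff_mk, PowerSeries.coeff_one]
  have h : ∀ s : Multiset L, (IsNested r s ∧ s.sup = ⊥) ∧ s.card = d ↔ s = 0 ∧ d = 0 := by
    intro s
    constructor
    · rintro ⟨⟨h1, h2⟩, rfl⟩
      simp [h1.eq_zero_of_sup h2]
    · rintro ⟨rfl, rfl⟩
      simp [isNested_zero]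
  rw [Nat.card_congr (Equiv.subtypeEquivRight h)]
  split_ifs with hd
  · simp [hd]
  · simp [hd]

open scoped Classical in
-- A nested multiset with supremum `v` is a nested one with some supremum `w < v` plus `a` copies of
-- `v`, where `1 ≤ a < r v - r w`. Bounds against elements below `w` follow from the one against
-- `w`.
theorem card_nested_sup [Fintype L] (hr : IsGeometricRank r) {v : L} (hv : v ≠ ⊥) (d : ℕ) :
    Nat.card {s : Multiset L // (IsNested r s ∧ s.sup = v) ∧ s.card = d} =
      ∑ w with w < v, ∑ a ∈ Finset.Ico 1 (r v - r w),
        Nat.card {s : Multiset L // (IsNested r s ∧ s.sup = w) ∧ s.card + a = d} := by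
  have hfin : ∀ (w : L) (a : ℕ),
      Finite {s : Multiset L // (IsNested r s ∧ s.sup = w) ∧ s.card + a = d} := by
    intro w a
    have := Multiset.finite_card_eq (fun s : Multiset L => IsNested r s ∧ s.sup = w) (d - a)
    exact Finite.of_injective
      (fun s : {s : Multiset L // (IsNested r s ∧ s.sup = w) ∧ s.card + a = d} =>
        (⟨s.1, s.2.1, by have := s.2.2; omega⟩ :
          {s : Multiset L // (IsNested r s ∧ s.sup = w) ∧ s.card = d - a}))
      fun s t h => Subtype.ext (Subtype.mk.inj h)
  set P : Finset (Σ _ : L, ℕ) :=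
    (Finset.univ.filter (· < v)).sigma fun w => Finset.Ico 1 (r v - r w) with hP
  have hmem : ∀ x : Σ _ : L, ℕ, x ∈ P ↔ x.1 < v ∧ 1 ≤ x.2 ∧ x.2 + r x.1 < r v := by
    intro x
    simp only [hP, Finset.mem_sigma, Finset.mem_filter, Finset.mem_univ, true_and, Finset.mem_Ico]
    refine and_congr_right fun _ => and_congr_right fun _ => ?_
    omega
  rw [← Finset.sum_sigma (Finset.univ.filter (· < v)) (fun w => Finset.Ico 1 (r v - r w))
    (fun x => Nat.card {s : Multiset L // (IsNested r s ∧ s.sup = x.1) ∧ s.card + x.2 = d}),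
    ← hP, ← Finset.sum_coe_sort, ← Nat.card_sigma]
  have hsup : ∀ (s : Multiset L) (n : ℕ), s.sup < v → 1 ≤ n →
      (s + Multiset.replicate n v).sup = v := by
    intro s n hs hn
    rw [Multiset.sup_add]
    refine le_antisymm (sup_le hs.le (Multiset.sup_le.2 fun b hb =>
      (Multiset.eq_of_mem_replicate hb).le)) (le_sup_of_le_right (Multiset.le_sup ?_))
    exact Multiset.mem_replicate.2 ⟨by omega, rfl⟩
  symm
  refine Nat.card_congr (Equiv.ofBijective (fun x => ⟨x.2.1 + Multiset.replicate x.1.1.2 v, ?_⟩)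
    ⟨?_, ?_⟩)
  · obtain ⟨⟨⟨w, a⟩, hx⟩, s, ⟨hs, hw⟩, hd⟩ := x
    obtain ⟨h1, h2, h3⟩ := (hmem _).1 hx
    dsimp only at *
    subst hw
    exact ⟨⟨hs.add_replicate hr h1 h3, hsup s a h1 h2⟩, by simpa using hd⟩
  · rintro ⟨⟨⟨w, a⟩, hx⟩, s, ⟨hs, hw⟩, hd⟩ ⟨⟨⟨w', a'⟩, hx'⟩, s', ⟨hs', hw'⟩, hd'⟩ h
    obtain rfl : s.sup = w := hw
    obtain rfl : s'.sup = w' := hw'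
    have h1 := ((hmem _).1 hx).1
    have h2 := ((hmem _).1 hx').1
    have h3 : s + Multiset.replicate a v = s' + Multiset.replicate a' v := Subtype.mk.inj h
    dsimp only at h1 h2
    have n1 : v ∉ s := fun hvs => (h1.trans_le (Multiset.le_sup hvs)).false
    have n2 : v ∉ s' := fun hvs => (h2.trans_le (Multiset.le_sup hvs)).false
    have h4 := congrArg (Multiset.count v) h3
    rw [Multiset.count_add, Multiset.count_add, Multiset.count_replicate_self,
      Multiset.count_replicate_self, Multiset.count_eq_zero_of_notMem n1,
      Multiset.count_eq_zero_of_notMem n2, zero_add, zero_add] at h4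
    subst h4
    have h5 := add_right_cancel h3
    subst h5
    rfl
  · rintro ⟨s, ⟨hs, hsv⟩, hd⟩
    obtain ⟨h1, h2, h3, h4, h5⟩ := hs.peel hsv hv
    refine ⟨⟨⟨⟨_, s.count v⟩, (hmem _).2 ⟨h2, h3, h4⟩⟩, _, ⟨h1, rfl⟩, ?_⟩, Subtype.ext h5.symm⟩
    conv_rhs => rw [← hd, h5]
    rw [Multiset.card_add, Multiset.card_replicate]

open scoped Classical in
theorem nestedSeries_eq_sum [Fintype L] (hr : IsGeometricRank r) {v : L} (hv : v ≠ ⊥) :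
    nestedSeries r v = ∑ w with w < v,
      (∑ a ∈ Finset.Ico 1 (r v - r w), PowerSeries.X ^ a) * nestedSeries r w := by
  ext d
  rw [nestedSeries, PowerSeries.coeff_mk, card_nested_sup hr hv, Nat.cast_sum, map_sum]
  refine Finset.sum_congr rfl fun w _ => ?_
  rw [Finset.sum_mul, map_sum, Nat.cast_sum]
  refine Finset.sum_congr rfl fun a _ => ?_
  rw [PowerSeries.coeff_X_pow_mul', nestedSeries, PowerSeries.coeff_mk]
  split_ifs with h
  · rw [Nat.cast_inj]
    exact Nat.card_congr (Equiv.subtypeEquivRight fun s => and_congr_right fun _ => by omega)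
  · rw [Nat.cast_eq_zero, Nat.card_eq_zero]
    left
    exact ⟨fun s => h (by have := s.2.2; omega)⟩

open scoped Classical in
-- The peeling recursion multiplied by `t - 1`, which sums the geometric series. The term `w = v`
-- contributes `(t - 1) N_v`.
theorem sum_mul_nestedSeries [Fintype L] (hr : IsGeometricRank r) {v : L} (hv : v ≠ ⊥) :
    ∑ w with w ≤ v, (PowerSeries.X - PowerSeries.X ^ (r v - r w)) * nestedSeries r w = 0 := by
  have e : Finset.univ.filter (· ≤ v) = insert v (Finset.univ.filter (· < v)) := by
    ext w
    simp [le_iff_eq_or_lt]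
  rw [e, Finset.sum_insert (by simp), Nat.sub_self, pow_zero]
  conv_lhs => enter [1]; rw [nestedSeries_eq_sum hr hv]
  rw [Finset.mul_sum, ← Finset.sum_add_distrib]
  refine Finset.sum_eq_zero fun w hw => ?_
  have hw : w < v := by simpa using hw
  have hlt := hr.strictMono hw
  have key := Finset.sum_Ico_eq_sub (fun a => (PowerSeries.X : PowerSeries ℚ) ^ a)
    (show 1 ≤ r v - r w by omega)
  have geom := geom_sum_mul (PowerSeries.X : PowerSeries ℚ) (r v - r w)
  rw [Finset.sum_range_one, pow_zero] at key
  rw [key]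
  linear_combination nestedSeries r w * geom

end Counting

/-! ### Counting subspaces of given dimension. -/

section Subspaces

variable (K V : Type*) [Field K] [AddCommGroup V] [Module K V] [Finite K] [Finite V]

/-- Linearly independent `k`-tuples in `V`, sorted by their span. -/
theorem card_submodule_mul (k : ℕ) (hk : k ≤ Module.finrank K V) :
    Nat.card {W : Submodule K V // Module.finrank K W = k} *
        ∏ i : Fin k, (Nat.card K ^ k - Nat.card K ^ i.val) =
      ∏ i : Fin k, (Nat.card K ^ Module.finrank K V - Nat.card K ^ i.val) := by
  have := Fintype.ofFinite K
  have := Fintype.ofFinite V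
  have := Fintype.ofFinite {W : Submodule K V // Module.finrank K W = k}
  rw [Nat.card_eq_fintype_card (α := K), ← card_linearIndependent hk]
  have h1 : ∀ W : {W : Submodule K V // Module.finrank K W = k},
      Nat.card {s : Fin k → W.1 // LinearIndependent K s} =
        ∏ i : Fin k, (Fintype.card K ^ k - Fintype.card K ^ i.val) := by
    intro W
    have := Fintype.ofFinite W.1
    rw [card_linearIndependent W.2.ge, W.2]
  have h2 : Nat.card (Σ W : {W : Submodule K V // Module.finrank K W = k},
      {s : Fin k → W.1 // LinearIndependent K s}) =
      Nat.card {W : Submodule K V // Module.finrank K W = k} *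
        ∏ i : Fin k, (Fintype.card K ^ k - Fintype.card K ^ i.val) := by
    rw [Nat.card_sigma, Finset.sum_congr rfl fun W _ => h1 W]
    simp
  rw [← h2]
  have hspan : ∀ (W : {W : Submodule K V // Module.finrank K W = k})
      (s : {s : Fin k → W.1 // LinearIndependent K s}),
      Submodule.span K (Set.range fun i => (s.1 i : V)) = W.1 := by
    intro W s
    have := s.2.span_eq_top_of_card_eq_finrank' (by rw [Fintype.card_fin, W.2])
    have h := congrArg (Submodule.map W.1.subtype) this
    rw [Submodule.map_span, ← Set.range_comp, Submodule.map_top, Submodule.range_subtype] at h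
    exact h
  refine Nat.card_congr (Equiv.ofBijective
    (fun x => ⟨fun i => (x.2.1 i : V), x.2.2.map' x.1.1.subtype (Submodule.ker_subtype _)⟩)
    ⟨?_, ?_⟩)
  · rintro ⟨⟨W, hW⟩, s⟩ ⟨⟨W', hW'⟩, s'⟩ h
    have h := Subtype.mk.inj h
    have e : W = W' := (hspan ⟨W, hW⟩ s).symm.trans
      ((congrArg (fun s => Submodule.span K (Set.range s)) h).trans (hspan ⟨W', hW'⟩ s'))
    subst e
    have : s = s' := Subtype.ext (funext fun i => Subtype.ext (congrFun h i))
    rw [this]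
  · rintro ⟨s, hs⟩
    refine ⟨⟨⟨Submodule.span K (Set.range s), ?_⟩,
      fun i => ⟨s i, Submodule.subset_span ⟨i, rfl⟩⟩, ?_⟩, rfl⟩
    · rw [finrank_span_eq_card hs, Fintype.card_fin]
    · exact LinearIndependent.of_comp (Submodule.span K (Set.range s)).subtype hs

end Subspaces

/-! ### Gaussian binomials and sums over subspaces. -/

section QFactorial

theorem qFactorial_succ (q n : ℕ) :
    qFactorial q (n + 1) = qFactorial q n * ∑ j ∈ Finset.range (n + 1), q ^ j := by
  rw [qFactorial, qFactorial, Finset.prod_Icc_succ_top (by omega)]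

theorem qFactorial_ne_zero (q n : ℕ) : (qFactorial q n : ℚ) ≠ 0 := by
  rw [Nat.cast_ne_zero, qFactorial, Finset.prod_ne_zero_iff]
  intro i hi
  have : 0 < i := by simp at hi; omega
  refine (Finset.sum_pos' (fun _ _ => Nat.zero_le _) ⟨0, by simpa using this, by simp⟩).ne'

theorem prod_pow_sub_pow_mul_qFactorial {q : ℕ} (hq : 1 ≤ q) (n k : ℕ) (hk : k ≤ n) :
    ((∏ i : Fin k, (q ^ n - q ^ i.val) : ℕ) : ℚ) * qFactorial q (n - k) =
      (∏ i ∈ Finset.range k, (q : ℚ) ^ i * (q - 1)) * qFactorial q n := by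
  rw [Finset.prod_range fun i => (q : ℚ) ^ i * (q - 1), Nat.cast_prod]
  induction k with
  | zero => simp
  | succ k ih =>
    rw [Fin.prod_univ_castSucc, Fin.prod_univ_castSucc]
    have ih := ih (by omega)
    obtain ⟨m, rfl⟩ : ∃ m, n = m + 1 + k := ⟨n - (k + 1), by omega⟩
    rw [show m + 1 + k - k = m + 1 by omega, qFactorial_succ, Nat.cast_mul] at ih
    rw [show m + 1 + k - (k + 1) = m by omega]
    simp only [Fin.val_castSucc, Fin.val_last]
    have e : ((q ^ (m + 1 + k) - q ^ k : ℕ) : ℚ) =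
        (q : ℚ) ^ k * (q - 1) * ((∑ j ∈ Finset.range (m + 1), q ^ j : ℕ) : ℚ) := by
      have geom := geom_sum_mul (q : ℚ) (m + 1)
      rw [Nat.cast_sub (Nat.pow_le_pow_right hq (by omega))]
      push_cast
      rw [pow_add _ (m + 1)]
      linear_combination -(q : ℚ) ^ k * geom
    rw [e]
    linear_combination (q : ℚ) ^ k * (q - 1) * ih

variable (K V : Type*) [Field K] [AddCommGroup V] [Module K V] [Finite K] [Finite V]

theorem card_submodule_finrank_eq (k l : ℕ) (h : k + l = Module.finrank K V) :
    (Nat.card {W : Submodule K V // Module.finrank K W = k} : ℚ) =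
      qFactorial (Nat.card K) (Module.finrank K V) *
        ((qFactorial (Nat.card K) k : ℚ)⁻¹ * (qFactorial (Nat.card K) l : ℚ)⁻¹) := by
  have hq : 1 < Nat.card K := Finite.one_lt_card
  have hq' : (1 : ℚ) < Nat.card K := by exact_mod_cast hq
  have h1 := congrArg (Nat.cast : ℕ → ℚ) (card_submodule_mul K V k (by omega))
  have h2 := prod_pow_sub_pow_mul_qFactorial hq.le (Module.finrank K V) k (by omega)
  have h3 := prod_pow_sub_pow_mul_qFactorial hq.le k k le_rfl
  have hc : (∏ i ∈ Finset.range k, (Nat.card K : ℚ) ^ i * (Nat.card K - 1)) ≠ 0 :=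
    Finset.prod_ne_zero_iff.2 fun i _ => mul_ne_zero (pow_ne_zero _ (by linarith)) (by linarith)
  have hk := qFactorial_ne_zero (Nat.card K) k
  have hl := qFactorial_ne_zero (Nat.card K) l
  rw [Nat.cast_mul] at h1
  rw [show Module.finrank K V - k = l by omega, ← h1] at h2
  rw [Nat.sub_self, show qFactorial (Nat.card K) 0 = 1 by simp [qFactorial], Nat.cast_one,
    mul_one] at h3
  rw [h3] at h2
  field_simp
  apply mul_left_cancel₀ hc
  linear_combination h2

open scoped Classical in
-- Turns sums over the subspace lattice into products of `q`-exponential generating functions.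
theorem sum_submodule_finrank [Fintype (Submodule K V)] (f : ℕ → ℕ → PowerSeries ℚ)
    (W : Submodule K V) {n : ℕ} (hn : Module.finrank K W = n) :
    ∑ U with U ≤ W, f (n - Module.finrank K U) (Module.finrank K U) =
      ∑ p ∈ Finset.HasAntidiagonal.antidiagonal n, ((qFactorial (Nat.card K) n : ℚ) *
        ((qFactorial (Nat.card K) p.1 : ℚ)⁻¹ * (qFactorial (Nat.card K) p.2 : ℚ)⁻¹)) •
          f p.1 p.2 := by
  have hmaps : ∀ U ∈ Finset.univ.filter (· ≤ W),
      (n - Module.finrank K U, Module.finrank K U) ∈ Finset.HasAntidiagonal.antidiagonal n := by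
    intro U hU
    have := Submodule.finrank_mono (show U ≤ W by simpa using hU)
    rw [Finset.HasAntidiagonal.mem_antidiagonal]
    dsimp only
    omega
  rw [← Finset.sum_fiberwise_of_maps_to hmaps]
  refine Finset.sum_congr rfl fun p hp => ?_
  rw [Finset.HasAntidiagonal.mem_antidiagonal] at hp
  have h1 : ∀ U ∈ (Finset.univ.filter (· ≤ W)).filter
      (fun U : Submodule K V => (n - Module.finrank K U, Module.finrank K U) = p),
      f (n - Module.finrank K U) (Module.finrank K U) = f p.1 p.2 := by
    intro U hU
    rw [← (Finset.mem_filter.1 hU).2]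
  rw [Finset.sum_congr rfl h1, Finset.sum_const, ← Nat.cast_smul_eq_nsmul ℚ]
  congr 1
  rw [mul_comm (_)⁻¹, ← hn, ← card_submodule_finrank_eq K W p.2 p.1 (by omega), Nat.cast_inj,
    ← Fintype.card_coe, ← Nat.card_eq_fintype_card]
  refine Nat.card_congr (Equiv.symm ((Equiv.subtypeEquiv (Submodule.mapIic W).toEquiv
    (q := fun U : Set.Iic W => Module.finrank K U.1 = p.2) fun U => ?_).trans
    ((Equiv.subtypeSubtypeEquivSubtypeInter (fun U : Submodule K V => U ∈ Set.Iic W)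
      (fun U => Module.finrank K U = p.2)).trans (Equiv.subtypeEquivRight fun U => ?_))))
  · change _ ↔ Module.finrank K (U.map W.subtype) = p.2
    rw [Submodule.finrank_map_subtype_eq]
  · simp only [Finset.mem_filter, Finset.mem_univ, true_and, Set.mem_Iic]
    refine and_congr_right fun hU => ⟨fun h => ?_, fun h => by rw [← h]⟩
    ext
    · dsimp only
      omega
    · exact h

end QFactorial

/-! ### Identification of the generating function. -/

section GeneratingFunction

/-- The denominator `t e_q(x) - e_q(t x)`. -/
noncomputable def qDenominator (q : ℕ) : PowerSeries (PowerSeries ℚ) :=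
  PowerSeries.C PowerSeries.X * qExp q - PowerSeries.rescale PowerSeries.X (qExp q)

theorem coeff_qExp (q n : ℕ) :
    PowerSeries.coeff n (qExp q) = (qFactorial q n : ℚ)⁻¹ • (1 : PowerSeries ℚ) := by
  rw [qExp, qEGF, PowerSeries.coeff_mk]

theorem coeff_qDenominator (q n : ℕ) : PowerSeries.coeff n (qDenominator q) =
    (qFactorial q n : ℚ)⁻¹ • (PowerSeries.X - PowerSeries.X ^ n) := by
  rw [qDenominator, map_sub, PowerSeries.coeff_C_mul, PowerSeries.coeff_rescale, coeff_qExp,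
    mul_smul_comm, mul_smul_comm, mul_one, mul_one, smul_sub]

theorem qFactorial_zero (q : ℕ) : qFactorial q 0 = 1 := by simp [qFactorial]

/-- The constant term in `x` is `t - 1`, invertible in `ℚ[[t]]`. -/
theorem isUnit_qDenominator (q : ℕ) : IsUnit (qDenominator q) := by
  rw [PowerSeries.isUnit_iff_constantCoeff, ← PowerSeries.coeff_zero_eq_constantCoeff_apply,
    coeff_qDenominator, PowerSeries.isUnit_iff_constantCoeff, qFactorial_zero]
  simp

/-- The series `(t - 1) / (t e_q(x) - e_q(t x))`. -/
noncomputable def qQuotient (q : ℕ) : PowerSeries (PowerSeries ℚ) :=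
  (PowerSeries.C PowerSeries.X - 1) * Ring.inverse (qDenominator q)

/-- The coefficient of `x ^ n / [n]_q!` in `(t - 1) / (t e_q(x) - e_q(t x))`. -/
noncomputable def qQuotientCoeff (q n : ℕ) : PowerSeries ℚ :=
  (qFactorial q n : ℚ) • PowerSeries.coeff n (qQuotient q)

theorem qDenominator_mul_qQuotient (q : ℕ) :
    qDenominator q * qQuotient q = PowerSeries.C PowerSeries.X - 1 := by
  rw [qQuotient, mul_left_comm, Ring.mul_inverse_cancel _ (isUnit_qDenominator q), mul_one]

theorem coeff_qQuotient (q n : ℕ) : PowerSeries.coeff n (qQuotient q) =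
    (qFactorial q n : ℚ)⁻¹ • qQuotientCoeff q n := by
  rw [qQuotientCoeff, inv_smul_smul₀ (qFactorial_ne_zero q n)]

theorem X_sub_one_ne_zero : (PowerSeries.X - 1 : PowerSeries ℚ) ≠ 0 := fun h => by
  simpa using congrArg PowerSeries.constantCoeff h

theorem qQuotientCoeff_zero (q : ℕ) : qQuotientCoeff q 0 = 1 := by
  have h := congrArg (PowerSeries.coeff 0) (qDenominator_mul_qQuotient q)
  rw [PowerSeries.coeff_mul, Finset.HasAntidiagonal.antidiagonal_zero, Finset.sum_singleton, coeff_qDenominator,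
    map_sub, PowerSeries.coeff_zero_C, PowerSeries.coeff_zero_one, qFactorial_zero] at h
  rw [qQuotientCoeff, qFactorial_zero]
  simp only [Nat.cast_one, inv_one, one_smul, pow_zero] at h ⊢
  exact mul_left_cancel₀ X_sub_one_ne_zero (h.trans (mul_one _).symm)

variable {K V : Type*} [Field K] [AddCommGroup V] [Module K V] [Finite K] [Finite V]
  [Fintype (Submodule K V)]

open scoped Classical in
-- This is the vanishing of the `x ^ n` coefficient of `qDenominator * qQuotient = t - 1` for `n =
-- dim W > 0`.
theorem sum_mul_qQuotientCoeff (W : Submodule K V) (hW : W ≠ ⊥) :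
    ∑ U with U ≤ W,
      (PowerSeries.X - PowerSeries.X ^ (Module.finrank K W - Module.finrank K U)) *
        qQuotientCoeff (Nat.card K) (Module.finrank K U) = 0 := by
  rw [sum_submodule_finrank K V
    (fun i j => (PowerSeries.X - PowerSeries.X ^ i) * qQuotientCoeff (Nat.card K) j) W rfl]
  have hn := (isGeometricRank_finrank K V).pos_of_ne_bot hW
  have h := congrArg (PowerSeries.coeff (Module.finrank K W))
    (qDenominator_mul_qQuotient (Nat.card K))
  rw [PowerSeries.coeff_mul, map_sub, PowerSeries.coeff_C, if_neg hn.ne', PowerSeries.coeff_one,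
    if_neg hn.ne', sub_zero] at h
  have h := congrArg ((qFactorial (Nat.card K) (Module.finrank K W) : ℚ) • ·) h
  rw [smul_zero, Finset.smul_sum] at h
  rw [← h]
  refine Finset.sum_congr rfl fun p _ => ?_
  rw [coeff_qDenominator, coeff_qQuotient, smul_mul_smul_comm, mul_smul]

/-- Both sides satisfy the same recursion, in which the top term has the nonzero factor `t - 1`. -/
theorem nestedSeries_submodule (n : ℕ) (W : Submodule K V) (hW : Module.finrank K W = n) :
    nestedSeries (fun W : Submodule K V => Module.finrank K W) W =
      qQuotientCoeff (Nat.card K) n := by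
  classical
  induction n using Nat.strong_induction_on generalizing W with
  | _ n ih =>
    by_cases h0 : W = ⊥
    · subst h0
      rw [finrank_bot] at hW
      rw [nestedSeries_bot, ← hW, qQuotientCoeff_zero]
    · subst hW
      have h1 := sum_mul_nestedSeries (isGeometricRank_finrank K V) h0
      have h2 := sum_mul_qQuotientCoeff W h0
      have e : Finset.univ.filter (· ≤ W) = insert W (Finset.univ.filter (· < W)) := by
        ext U
        simp [le_iff_eq_or_lt]
      rw [e, Finset.sum_insert (by simp), Nat.sub_self, pow_zero] at h1 h2
      have h3 : ∀ U ∈ Finset.univ.filter (· < W),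
          (PowerSeries.X - PowerSeries.X ^ (Module.finrank K W - Module.finrank K U)) *
            nestedSeries (fun W : Submodule K V => Module.finrank K W) U =
          (PowerSeries.X - PowerSeries.X ^ (Module.finrank K W - Module.finrank K U)) *
            qQuotientCoeff (Nat.card K) (Module.finrank K U) := by
        intro U hU
        have hU : U < W := by simpa using hU
        rw [ih _ (Submodule.finrank_lt_finrank_of_lt hU) U rfl]
      rw [Finset.sum_congr rfl h3] at h1
      exact mul_left_cancel₀ X_sub_one_ne_zero (add_right_cancel (h1.trans h2.symm))

variable (K V) in
theorem hilbertSeries_chowComponent :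
    hilbertSeries (Matroid.ofVectorSpace K V).chowComponent =
      (qFactorial (Nat.card K) (Module.finrank K V) : ℚ) •
        PowerSeries.coeff (Module.finrank K V) (qExp (Nat.card K) * qQuotient (Nat.card K)) := by
  classical
  have h1 : hilbertSeries (Matroid.ofVectorSpace K V).chowComponent =
      ∑ W, nestedSeries (fun W : Submodule K V => Module.finrank K W) W := by
    rw [sum_nestedSeries, hilbertSeries]
    congr 1
    funext d
    rw [← Matroid.finrank_chowComponent]
  have h2 := sum_submodule_finrank K V (fun _ j => qQuotientCoeff (Nat.card K) j) ⊤
    (finrank_top K V)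
  rw [h1, Finset.sum_congr rfl fun W _ => nestedSeries_submodule _ W rfl, PowerSeries.coeff_mul,
    Finset.smul_sum]
  simp only [le_top, Finset.filter_true] at h2
  rw [h2]
  refine Finset.sum_congr rfl fun p _ => ?_
  rw [coeff_qExp, coeff_qQuotient, smul_mul_smul_comm, mul_smul, one_mul]

end GeneratingFunction

theorem mainTheorem11 (K : Type*) [Field K] [Finite K] (q : ℕ) (hq : Nat.card K = q)
    (h : ℕ → PowerSeries ℚ)
    (hh : ∀ n, h n = hilbertSeries (Matroid.ofVectorSpace K (Fin n → K)).chowComponent)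
    (t : PowerSeries ℚ) (ht : t = PowerSeries.X) :
    IsUnit (PowerSeries.C t * qExp q - PowerSeries.rescale t (qExp q)) ∧
    qEGF q h =
      (PowerSeries.C t - 1) * qExp q *
        Ring.inverse (PowerSeries.C t * qExp q - PowerSeries.rescale t (qExp q)) := by
  subst ht hq
  refine ⟨isUnit_qDenominator _, ?_⟩
  change _ = _ * Ring.inverse (qDenominator _)
  rw [mul_right_comm, mul_comm, ← qQuotient]
  ext1 n
  have := Fintype.ofFinite (Submodule K (Fin n → K))
  rw [qEGF, PowerSeries.coeff_mk, hh, hilbertSeries_chowComponent, Module.finrank_fin_fun,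
    inv_smul_smul₀ (qFactorial_ne_zero _ n)]
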